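/- A (finite) hypergraph $H$ consists of a finite set $V(H)$ of vertices and a set $E(H) \subseteq 2^{V(H)}$ of edges; its size is $\|H\| = |V(H)| + |E(H)|$. A nest-set of $H$ is a non-empty set $s \subseteq V(H)$ such that $\{\, e \setminus s \mid e \in E(H),\ e \cap s \neq \emptyset \,\}$ is linearly ordered by $\subseteq$; it is a $k$-nest-set if $|s| \le k$. Theorem 5.6. There is an algorithm that takes as input a hypergraph $H$ and an integer $k \ge 1$, runs in time $2^{O(k^2)} \cdot \mathrm{poly}(\|H\|)$, and returns a $k$-nest-set of $H$ if one exists, and rejects otherwise. -/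

import Mathlib

/-! ### Nest-sets of hypergraphs (on Mathlib's `Hypergraph`) -/

namespace Hypergraph

/-- `I(s, H)`: the edges of `H` that contain at least one vertex of `s`. -/
def incidentEdges {α : Type*} (H : Hypergraph α) (s : Set α) : Set (Set α) :=
  {e | e ∈ H.edgeSet ∧ ∃ v ∈ s, v ∈ e}

/-- The set `{e \ s | e ∈ I(s, H)}`. -/
def incidentRemainders {α : Type*} (H : Hypergraph α) (s : Set α) : Set (Set α) :=
  (fun e => e \ s) '' H.incidentEdges s

/-- A nest-set of `H`: a non-empty set `s` of vertices such that `{e \ s | e ∈ I(s, H)}` is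
linearly ordered by `⊆`. -/
structure IsNestSet {α : Type*} (H : Hypergraph α) (s : Set α) : Prop where
  nonempty : s.Nonempty
  subset : s ⊆ H.vertexSet
  chain : IsChain (fun a b : Set α => a ⊆ b) (H.incidentRemainders s)

/-- A `k`-nest-set of `H`: a nest-set with at most `k` elements. -/
def IsKNestSet {α : Type*} (H : Hypergraph α) (k : ℕ) (s : Set α) : Prop :=
  H.IsNestSet s ∧ s.encard ≤ k

/-- The size `‖H‖ = |V(H)| + |E(H)|` of a (finite) hypergraph. -/
noncomputable def size {α : Type*} (H : Hypergraph α) : ℕ :=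
  H.vertexSet.ncard + H.edgeSet.ncard

end Hypergraph

/-! ### Random access machines

Structured programs for a random access machine. The machine has registers, which a program
addresses by fixed numbers, and a memory, which it addresses indirectly through registers; both
hold natural numbers. The arithmetic is addition and truncated subtraction (there is no
multiplication, so that a number grows by at most one bit per step), and every instruction and
every test of a register costs one step. -/

namespace RAM

/-- A configuration of the machine: the contents of the registers and of the memory. -/
structure State where
  reg : ℕ → ℕ
  mem : ℕ → ℕ

/-- Programs. -/
inductive Prog where
  /-- do nothing -/
  | skip : Prog
  /-- `x := c` for a constant `c` -/
  | const (x c : ℕ) : Prog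
  /-- `x := y` -/
  | copy (x y : ℕ) : Prog
  /-- `x := y + z` -/
  | add (x y z : ℕ) : Prog
  /-- `x := max (y - z) 0` -/
  | sub (x y z : ℕ) : Prog
  /-- `x := mem[y]` -/
  | load (x y : ℕ) : Prog
  /-- `mem[x] := y` -/
  | store (x y : ℕ) : Prog
  /-- run the first program, then the second one -/
  | seq (p q : Prog) : Prog
  /-- run the first program if `x ≠ 0`, and the second one if `x = 0` -/
  | ifNZ (x : ℕ) (p q : Prog) : Prog
  /-- repeat the program as long as `x ≠ 0` -/
  | whileNZ (x : ℕ) (p : Prog) : Prog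

/-- Write the value `a` into register `x`. -/
def State.setReg (σ : State) (x a : ℕ) : State :=
  ⟨Function.update σ.reg x a, σ.mem⟩

/-- Write the value `a` into the memory cell with address `i`. -/
def State.setMem (σ : State) (i a : ℕ) : State :=
  ⟨σ.reg, Function.update σ.mem i a⟩

/-- `Exec p σ t τ`: the program `p`, started in `σ`, halts in `τ` after exactly `t` steps. -/
inductive Exec : Prog → State → ℕ → State → Prop where
  | skip (σ : State) : Exec .skip σ 1 σ
  | const (σ : State) (x c : ℕ) : Exec (.const x c) σ 1 (σ.setReg x c)
  | copy (σ : State) (x y : ℕ) : Exec (.copy x y) σ 1 (σ.setReg x (σ.reg y))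
  | add (σ : State) (x y z : ℕ) : Exec (.add x y z) σ 1 (σ.setReg x (σ.reg y + σ.reg z))
  | sub (σ : State) (x y z : ℕ) : Exec (.sub x y z) σ 1 (σ.setReg x (σ.reg y - σ.reg z))
  | load (σ : State) (x y : ℕ) : Exec (.load x y) σ 1 (σ.setReg x (σ.mem (σ.reg y)))
  | store (σ : State) (x y : ℕ) : Exec (.store x y) σ 1 (σ.setMem (σ.reg x) (σ.reg y))
  | seq {p q : Prog} {σ τ ρ : State} {t u : ℕ} (hp : Exec p σ t τ) (hq : Exec q τ u ρ) :
      Exec (.seq p q) σ (t + u) ρ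
  | ifNZ_true {x : ℕ} {p q : Prog} {σ τ : State} {t : ℕ} (hx : σ.reg x ≠ 0)
      (hp : Exec p σ t τ) : Exec (.ifNZ x p q) σ (t + 1) τ
  | ifNZ_false {x : ℕ} {p q : Prog} {σ τ : State} {t : ℕ} (hx : σ.reg x = 0)
      (hq : Exec q σ t τ) : Exec (.ifNZ x p q) σ (t + 1) τ
  | whileNZ_done {x : ℕ} {p : Prog} {σ : State} (hx : σ.reg x = 0) :
      Exec (.whileNZ x p) σ 1 σ
  | whileNZ_step {x : ℕ} {p : Prog} {σ τ ρ : State} {t u : ℕ} (hx : σ.reg x ≠ 0)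
      (hp : Exec p σ t τ) (hw : Exec (.whileNZ x p) τ u ρ) :
      Exec (.whileNZ x p) σ (t + u + 1) ρ

end RAM

/-! ### Input and output -/

namespace Hypergraph

open Classical in
/-- The initial configuration for the input `(H, k)`, where the vertices of `H` are listed as
`vs 0, …, vs (n - 1)` and the edges of `H` as `es 0, …, es (m - 1)`: registers `0`, `1`, `2` hold
`n`, `m`, `k`, and the memory holds the `m × n` incidence matrix of `H` row by row, i.e. cell
`i * n + j` holds `1` if `vs j ∈ es i`, and `0` if not. Everything else is `0`. -/
noncomputable def inputState {α : Type*} (H : Hypergraph α) {n m : ℕ}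
    (vs : Fin n ≃ H.vertexSet) (es : Fin m ≃ H.edgeSet) (k : ℕ) : RAM.State where
  reg x := if x = 0 then n else if x = 1 then m else if x = 2 then k else 0
  mem a := if ∃ (i : Fin m) (j : Fin n), a = i * n + j ∧ (vs j : α) ∈ (es i : Set α)
    then 1 else 0

/-- The final configuration `σ` rejects: register `0` holds `0`. -/
def Rejects (σ : RAM.State) : Prop := σ.reg 0 = 0

/-- The final configuration `σ` accepts and returns the set `s` of vertices: register `0` holds
`1`, and register `1` holds the address of an array of length `n` that is the characteristic
vector of `s` with respect to the list `vs` of the vertices of `H`. -/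
def Returns {α : Type*} (H : Hypergraph α) {n : ℕ} (vs : Fin n ≃ H.vertexSet)
    (σ : RAM.State) (s : Set α) : Prop :=
  σ.reg 0 = 1 ∧
    ∀ j : Fin n, ((vs j : α) ∈ s → σ.mem (σ.reg 1 + j) = 1) ∧
      ((vs j : α) ∉ s → σ.mem (σ.reg 1 + j) = 0)

end Hypergraph

/-! Call two edges A, B bad for S if both meet S and A \ S, B \ S are incomparable. If S lies in a
nest-set s and A, B are bad for S, then A \ B or B \ A lies in s, since otherwise the pair would be
bad for s as well. So s can be approached from below: start with one of its vertices and, for each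
bad pair met, add one of the two differences. Every addition is strict, so the right choices fit
into a binary guess below 2^|s|, and the result is a nest-set inside s (`tracks_step`,
`exists_run_subset`).

Conversely, every guess ends in a nest-set: a pass over all pairs either adds a vertex or proves
that no pair is bad, so n passes suffice (`nest_run`). Hence a k-nest-set exists iff some starting
vertex and some guess below 2^k give a set of size at most k (`exists_solution_iff`).

The search is a pure function on pairs (guess, set). Each machine loop is shown to compute its layer
of this function by a counter invariant (`wp_whileNZ`), up to `wp_prog`. Guesses contribute one
factor 2^k and bit extraction without division another, so the time is 4^k times a polynomial
(`time_le`). `isKNestSet_iff` translates between vertex sets and index sets. -/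

namespace RAM

/-! ### Weakest preconditions -/

/-- The program `p`, started in `σ`, halts after some number `t` of steps in some state `τ` with
`Q t τ`. -/
def wp (p : Prog) (Q : ℕ → State → Prop) (σ : State) : Prop :=
  ∃ t τ, Exec p σ t τ ∧ Q t τ

section
variable {σ : State} {Q : ℕ → State → Prop} {p q : Prog} {x y z c : ℕ}

theorem wp.mono {R : ℕ → State → Prop} (h : wp p Q σ) (hQ : ∀ t τ, Q t τ → R t τ) :
    wp p R σ := by
  obtain ⟨t, τ, h, h'⟩ := h
  exact ⟨t, τ, h, hQ _ _ h'⟩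

theorem wp_skip (h : Q 1 σ) : wp .skip Q σ := ⟨_, _, .skip σ, h⟩

-- Inverting the only applicable rule of `Exec` gives an equivalence, here and for the other
-- instructions; as `simp` rules these execute loop-free code symbolically.
@[simp] theorem wp_skip_iff : wp .skip Q σ ↔ Q 1 σ :=
  ⟨fun ⟨_, _, h, h'⟩ => by cases h; exact h', wp_skip⟩

@[simp] theorem wp_const_iff : wp (.const x c) Q σ ↔ Q 1 (σ.setReg x c) :=
  ⟨fun ⟨_, _, h, h'⟩ => by cases h; exact h', fun h => ⟨_, _, .const .., h⟩⟩

@[simp] theorem wp_copy_iff : wp (.copy x y) Q σ ↔ Q 1 (σ.setReg x (σ.reg y)) :=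
  ⟨fun ⟨_, _, h, h'⟩ => by cases h; exact h', fun h => ⟨_, _, .copy .., h⟩⟩

@[simp] theorem wp_add_iff :
    wp (.add x y z) Q σ ↔ Q 1 (σ.setReg x (σ.reg y + σ.reg z)) :=
  ⟨fun ⟨_, _, h, h'⟩ => by cases h; exact h', fun h => ⟨_, _, .add .., h⟩⟩

@[simp] theorem wp_sub_iff :
    wp (.sub x y z) Q σ ↔ Q 1 (σ.setReg x (σ.reg y - σ.reg z)) :=
  ⟨fun ⟨_, _, h, h'⟩ => by cases h; exact h', fun h => ⟨_, _, .sub .., h⟩⟩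

@[simp] theorem wp_load_iff :
    wp (.load x y) Q σ ↔ Q 1 (σ.setReg x (σ.mem (σ.reg y))) :=
  ⟨fun ⟨_, _, h, h'⟩ => by cases h; exact h', fun h => ⟨_, _, .load .., h⟩⟩

@[simp] theorem wp_store_iff :
    wp (.store x y) Q σ ↔ Q 1 (σ.setMem (σ.reg x) (σ.reg y)) :=
  ⟨fun ⟨_, _, h, h'⟩ => by cases h; exact h', fun h => ⟨_, _, .store .., h⟩⟩

@[simp] theorem wp_seq_iff :
    wp (.seq p q) Q σ ↔ wp p (fun t τ => wp q (fun u ρ => Q (t + u) ρ) τ) σ :=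
  ⟨fun ⟨_, _, h, h'⟩ => by cases h with | seq hp hq => exact ⟨_, _, hp, _, _, hq, h'⟩,
    fun ⟨_, _, hp, _, _, hq, h'⟩ => ⟨_, _, .seq hp hq, h'⟩⟩

@[simp] theorem wp_ifNZ_iff :
    wp (.ifNZ x p q) Q σ ↔
      if σ.reg x = 0 then wp q (fun t => Q (t + 1)) σ else wp p (fun t => Q (t + 1)) σ := by
  split_ifs with hx
  · refine ⟨fun ⟨_, _, h, h'⟩ => ?_, fun ⟨_, _, h, h'⟩ => ⟨_, _, .ifNZ_false hx h, h'⟩⟩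
    cases h with
    | ifNZ_true h1 _ => exact absurd hx h1
    | ifNZ_false _ h => exact ⟨_, _, h, h'⟩
  · refine ⟨fun ⟨_, _, h, h'⟩ => ?_, fun ⟨_, _, h, h'⟩ => ⟨_, _, .ifNZ_true hx h, h'⟩⟩
    cases h with
    | ifNZ_true _ h => exact ⟨_, _, h, h'⟩
    | ifNZ_false h1 _ => exact absurd h1 hx

end

@[simp] theorem State.reg_setReg (σ : State) (x a y : ℕ) :
    (σ.setReg x a).reg y = if y = x then a else σ.reg y := by
  simp [State.setReg, Function.update_apply]

@[simp] theorem State.mem_setReg (σ : State) (x a : ℕ) : (σ.setReg x a).mem = σ.mem := rfl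

@[simp] theorem State.reg_setMem (σ : State) (i a : ℕ) : (σ.setMem i a).reg = σ.reg := rfl

@[simp] theorem State.mem_setMem (σ : State) (i a j : ℕ) :
    (σ.setMem i a).mem j = if j = i then a else σ.mem j := by
  simp [State.setMem, Function.update_apply]

/-! ### Frames -/

/-- The program `p` writes to no register below `b`. -/
def Prog.Keeps (b : ℕ) : Prog → Prop
  | .skip => True
  | .const x _ | .copy x _ | .add x _ _ | .sub x _ _ | .load x _ => b ≤ x
  | .store _ _ => True
  | .seq p q | .ifNZ _ p q => p.Keeps b ∧ q.Keeps b
  | .whileNZ _ p => p.Keeps b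

/-- The registers below `b` have the same contents in `τ` as in `σ`. -/
def Agree (b : ℕ) (σ τ : State) : Prop := ∀ r < b, τ.reg r = σ.reg r

theorem Agree.refl (b : ℕ) (σ : State) : Agree b σ σ := fun _ _ => rfl

theorem Agree.trans {b : ℕ} {σ τ ρ : State} (h : Agree b σ τ) (h' : Agree b τ ρ) :
    Agree b σ ρ := fun r hr => (h' r hr).trans (h r hr)

theorem Agree.mono {b c : ℕ} {σ τ : State} (h : Agree b σ τ) (hc : c ≤ b) : Agree c σ τ :=
  fun r hr => h r (hr.trans_le hc)

theorem Agree.setReg {b : ℕ} {σ : State} {x a : ℕ} (hx : b ≤ x) :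
    Agree b σ (σ.setReg x a) := fun r hr => by
  rw [State.reg_setReg, if_neg (by omega)]

theorem Exec.agree {p : Prog} {σ τ : State} {t b : ℕ} (h : Exec p σ t τ) (hp : p.Keeps b) :
    Agree b σ τ := by
  induction h with
  | skip | store | whileNZ_done => exact .refl _ _
  | const | copy | add | sub | load => exact .setReg hp
  | seq _ _ ih ih' => exact (ih hp.1).trans (ih' hp.2)
  | ifNZ_true _ _ ih => exact ih hp.1
  | ifNZ_false _ _ ih => exact ih hp.2
  | whileNZ_step _ _ _ ih ih' => exact (ih hp).trans (ih' hp)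

/-- Outer loops keep their data in lower registers than inner ones, so this syntactic check spares
the inner invariants from mentioning the outer counters. -/
theorem wp.frame {p : Prog} {σ : State} {Q : ℕ → State → Prop} {b : ℕ} (hp : p.Keeps b)
    (h : wp p Q σ) : wp p (fun t τ => Agree b σ τ ∧ Q t τ) σ := by
  obtain ⟨t, τ, h, h'⟩ := h
  exact ⟨t, τ, h, h.agree hp, h'⟩

/-- A loop whose counter `c` decreases by one with every round; the invariant `I i` holds whenever
the counter is `i`. -/
theorem wp_whileNZ {c b T : ℕ} {p : Prog} {σ : State} (I : ℕ → State → Prop) (N : ℕ)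
    (hp : p.Keeps b) (hc : ∀ i τ, I i τ → τ.reg c = i)
    (hI : ∀ i < N, ∀ τ, Agree b σ τ → I (i + 1) τ → wp p (fun t ρ => t < T ∧ I i ρ) τ)
    (h : I N σ) :
    wp (.whileNZ c p) (fun t τ => t ≤ N * T + 1 ∧ Agree b σ τ ∧ I 0 τ) σ := by
  suffices H : ∀ i ≤ N, ∀ τ, Agree b σ τ → I i τ →
      wp (.whileNZ c p) (fun t τ => t ≤ i * T + 1 ∧ Agree b σ τ ∧ I 0 τ) τ from
    H N le_rfl σ (.refl _ _) h
  intro i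
  induction i with
  | zero =>
    intro _ τ hτ hi
    exact ⟨1, τ, .whileNZ_done (hc _ _ hi), by simp, hτ, hi⟩
  | succ i ih =>
    intro hiN τ hτ hi
    obtain ⟨t, ρ, he, ht, hρ⟩ := hI i (by omega) τ hτ hi
    obtain ⟨u, ν, he', hu, hν⟩ := ih (by omega) ρ (hτ.trans (he.agree hp)) hρ
    refine ⟨t + u + 1, ν, .whileNZ_step ?_ he he', ?_, hν⟩
    · rw [hc _ _ hi]; omega
    -- The strict bound `t < T` pays for the test of the counter in each round.
    · rw [Nat.succ_mul]; omega

end RAM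

/-! ### The search on finite sets -/

namespace NestSearch

/-- Apply `f (N - 1)`, …, `f 0`, in this order. -/
def down {X : Type*} (f : ℕ → X → X) : ℕ → X → X
  | 0, a => a
  | c + 1, a => down f c (f c a)

/-- Some pair of edges that meet `S` has remainders outside of `S` that are incomparable. -/
def Violates (A B S : Finset ℕ) : Prop :=
  (∃ j ∈ A, j ∈ S) ∧ (∃ j ∈ B, j ∈ S) ∧ (∃ j ∈ A, j ∉ B ∧ j ∉ S) ∧ ∃ j ∈ B, j ∉ A ∧ j ∉ S

open Classical in
/-- If the edges `A` and `B` violate the nest-set condition for the current set, then add one of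
their differences to it, depending on the last bit of the guess, and drop this bit. -/
noncomputable def step (A B : Finset ℕ) (a : ℕ × Finset ℕ) : ℕ × Finset ℕ :=
  if Violates A B a.2 then
    (a.1 / 2, a.2 ∪ if a.1 % 2 = 0 then B \ A else A \ B)
  else a

/-- Go once through all pairs of edges. -/
noncomputable def pass (E : ℕ → Finset ℕ) (m : ℕ) : ℕ × Finset ℕ → ℕ × Finset ℕ :=
  down (fun i => down (fun i' => step (E i) (E i')) m) m

/-- The search with the starting vertex `v` and the guess `b`. -/
noncomputable def run (E : ℕ → Finset ℕ) (n m v b : ℕ) : ℕ × Finset ℕ :=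
  down (fun _ => pass E m) n (b, {v})

/-- The edges `E 0`, …, `E (m - 1)` satisfy the nest-set condition for `S`. -/
def Nest (E : ℕ → Finset ℕ) (m : ℕ) (S : Finset ℕ) : Prop :=
  ∀ i < m, ∀ i' < m, ¬ Violates (E i) (E i') S

/-! ### Every guess leads to a nest-set. -/

theorem down_induction {X : Type*} {f : ℕ → X → X} {N : ℕ} (R : X → X → Prop)
    (hr : ∀ a, R a a) (ht : ∀ a b c, R a b → R b c → R a c) (hf : ∀ c < N, ∀ a, R a (f c a))
    (a : X) : R a (down f N a) := by
  induction N generalizing a with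
  | zero => exact hr a
  | succ N ih =>
    exact ht _ _ _ (hf N (by omega) a) (ih (fun c hc => hf c (by omega)) _)

theorem subset_step (A B : Finset ℕ) (a : ℕ × Finset ℕ) : a.2 ⊆ (step A B a).2 := by
  unfold step
  split_ifs <;> simp

theorem step_subset (A B T : Finset ℕ) (hA : A ⊆ T) (hB : B ⊆ T) (a : ℕ × Finset ℕ)
    (ha : a.2 ⊆ T) : (step A B a).2 ⊆ T := by
  unfold step
  split_ifs
  · exact Finset.union_subset ha (Finset.sdiff_subset.trans hB)
  · exact Finset.union_subset ha (Finset.sdiff_subset.trans hA)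
  · exact ha

theorem step_fst_le (A B : Finset ℕ) (a : ℕ × Finset ℕ) : (step A B a).1 ≤ a.1 := by
  unfold step
  split_ifs <;> simp [Nat.div_le_self]

/-- A violation puts an element outside the current set into each of the two differences, so
whichever is added, the set grows. -/
theorem not_violates_of_step_eq {A B : Finset ℕ} {a : ℕ × Finset ℕ}
    (h : (step A B a).2 = a.2) : ¬ Violates A B a.2 := by
  intro hv
  obtain ⟨-, -, ⟨j, hjA, hjB, hjS⟩, ⟨l, hlB, hlA, hlS⟩⟩ := id hv
  simp only [step, if_pos hv, Finset.union_eq_left] at h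
  split_ifs at h
  · exact hlS (h (by simp [hlA, hlB]))
  · exact hjS (h (by simp [hjA, hjB]))

/-- The sets only grow, so an unchanged final set means that no application added anything. By `hf`
the guess is then unchanged too, and every `f c` was applied to the same `a`. -/
theorem down_eq_self {f : ℕ → ℕ × Finset ℕ → ℕ × Finset ℕ} {N : ℕ}
    (hs : ∀ c < N, ∀ a, a.2 ⊆ (f c a).2) {a : ℕ × Finset ℕ} (h : (down f N a).2 = a.2)
    (hf : ∀ c < N, (f c a).2 = a.2 → f c a = a) : ∀ c < N, f c a = a := by
  induction N with
  | zero => intro c hc; omega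
  | succ N ih =>
    have h1 : (f N a).2 = a.2 := by
      refine (Finset.Subset.antisymm (hs N (by omega) a) ?_).symm
      refine le_trans (b := (down f (N + 1) a).2) ?_ h.le
      exact down_induction (fun a b : ℕ × Finset ℕ => a.2 ⊆ b.2) (fun _ => subset_rfl)
        (fun _ _ _ => Finset.Subset.trans) (fun c hc => hs c (by omega)) _
    have h2 := hf N (by omega) h1
    intro c hc
    rcases Nat.lt_succ_iff_lt_or_eq.1 hc with hc | rfl
    · refine ih (fun c hc => hs c (by omega)) ?_ (fun c hc => hf c (by omega)) c hc
      rw [down, h2] at h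
      exact h
    · exact h2

theorem step_eq_self {A B : Finset ℕ} {a : ℕ × Finset ℕ} (h : ¬ Violates A B a.2) :
    step A B a = a := if_neg h

theorem down_fixed {X : Type*} {f : ℕ → X → X} {N : ℕ} {a : X} (h : ∀ c < N, f c a = a) :
    down f N a = a := by
  induction N with
  | zero => rfl
  | succ N ih => rw [down, h N (by omega), ih fun c hc => h c (by omega)]

theorem subset_down_step (A : Finset ℕ) (E : ℕ → Finset ℕ) (m : ℕ) (a : ℕ × Finset ℕ) :
    a.2 ⊆ (down (fun i' => step A (E i')) m a).2 :=
  down_induction (fun a b : ℕ × Finset ℕ => a.2 ⊆ b.2) (fun _ => subset_rfl)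
    (fun _ _ _ => Finset.Subset.trans) (fun _ _ _ => subset_step _ _ _) _

theorem subset_pass (E : ℕ → Finset ℕ) (m : ℕ) (a : ℕ × Finset ℕ) : a.2 ⊆ (pass E m a).2 :=
  down_induction (fun a b : ℕ × Finset ℕ => a.2 ⊆ b.2) (fun _ => subset_rfl)
    (fun _ _ _ => Finset.Subset.trans) (fun _ _ _ => subset_down_step _ _ _ _) _

/-- A pass that adds nothing has tested all pairs against one and the same set; `down_eq_self` is
used for the inner and for the outer loop. -/
theorem nest_of_pass_eq {E : ℕ → Finset ℕ} {m : ℕ} {a : ℕ × Finset ℕ}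
    (h : (pass E m a).2 = a.2) : Nest E m a.2 := by
  have inner (i : ℕ) (hi : (down (fun i' => step (E i) (E i')) m a).2 = a.2) :
      ∀ i' < m, ¬ Violates (E i) (E i') a.2 := by
    intro i' hi'
    have := down_eq_self (fun c _ a => subset_step (E i) (E c) a) hi
      (fun c _ hc => step_eq_self (not_violates_of_step_eq hc)) i' hi'
    exact not_violates_of_step_eq (congrArg Prod.snd this)
  intro i hi
  refine inner i ?_
  have := down_eq_self (fun c _ a => subset_down_step (E c) E m a) h
    (fun c _ hc => down_fixed fun i' hi' => step_eq_self (inner c hc i' hi')) i hi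
  exact congrArg Prod.snd this

theorem pass_eq_self {E : ℕ → Finset ℕ} {m : ℕ} {a : ℕ × Finset ℕ} (h : Nest E m a.2) :
    pass E m a = a :=
  down_fixed fun i hi => down_fixed fun i' hi' => step_eq_self (h i hi i' hi')

theorem pass_subset {E : ℕ → Finset ℕ} {m : ℕ} {T : Finset ℕ} (hE : ∀ i < m, E i ⊆ T)
    {a : ℕ × Finset ℕ} (ha : a.2 ⊆ T) : (pass E m a).2 ⊆ T :=
  down_induction (fun a b : ℕ × Finset ℕ => a.2 ⊆ T → b.2 ⊆ T) (fun _ => id)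
    (fun _ _ _ h h' => h' ∘ h) (fun i hi => down_induction
    (fun a b : ℕ × Finset ℕ => a.2 ⊆ T → b.2 ⊆ T) (fun _ => id) (fun _ _ _ h h' => h' ∘ h) (fun i' hi' a => step_subset _ _ _ (hE i hi) (hE i' hi') a)) a ha

/-- The first pass that adds nothing reaches a fixed point; until then each pass adds at least one
element. -/
theorem nest_or_card_le {E : ℕ → Finset ℕ} {m : ℕ} (r : ℕ) (a : ℕ × Finset ℕ) :
    Nest E m (down (fun _ => pass E m) r a).2 ∨
      a.2.card + r ≤ (down (fun _ => pass E m) r a).2.card := by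
  induction r generalizing a with
  | zero => exact .inr le_rfl
  | succ r ih =>
    rw [down]
    by_cases h : (pass E m a).2 = a.2
    · have hn := nest_of_pass_eq h
      rw [pass_eq_self hn, down_fixed fun _ _ => pass_eq_self hn]
      exact .inl hn
    · have := Finset.card_lt_card ((subset_pass E m a).ssubset_of_ne (Ne.symm h))
      exact (ih _).imp_right fun _ => by omega

theorem run_subset {E : ℕ → Finset ℕ} {n m v b : ℕ}
    (hE : ∀ i < m, E i ⊆ Finset.range n) (hv : v < n) : (run E n m v b).2 ⊆ Finset.range n :=
  down_induction (fun a b : ℕ × Finset ℕ => a.2 ⊆ Finset.range n → b.2 ⊆ Finset.range n)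
    (fun _ => id) (fun _ _ _ h h' => h' ∘ h) (fun _ _ _ => pass_subset hE) _ (by simpa)

theorem nest_run {E : ℕ → Finset ℕ} {n m v b : ℕ}
    (hE : ∀ i < m, E i ⊆ Finset.range n) (hv : v < n) : Nest E m (run E n m v b).2 := by
  -- Starting from one element, `n` growing passes would give `n + 1` elements below `n`.
  refine (nest_or_card_le n (b, {v})).resolve_right fun h => ?_
  have := Finset.card_le_card (run_subset (b := b) hE hv)
  simp only [Finset.card_singleton, Finset.card_range] at h this
  unfold run at this
  omega

theorem mem_run (E : ℕ → Finset ℕ) (n m v b : ℕ) : v ∈ (run E n m v b).2 :=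
  down_induction (fun a b : ℕ × Finset ℕ => a.2 ⊆ b.2) (fun _ => subset_rfl)
    (fun _ _ _ => Finset.Subset.trans) (fun _ _ => subset_pass E m) (b, {v})
    (Finset.mem_singleton_self v)

/-! ### A suitable guess stays inside a given nest-set. -/

/-- With suitable guesses, `f` leads from subsets of `s` to subsets of `s`. -/
def Tracks (s : Finset ℕ) (f : ℕ × Finset ℕ → ℕ × Finset ℕ) : Prop :=
  ∀ S ⊆ s, ∃ S' ⊆ s, ∀ y < 2 ^ (s \ S').card, ∃ x < 2 ^ (s \ S).card, f (x, S) = (y, S')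

/-- In `Tracks` the set `S'` is chosen before `y`: the sets are determined forwards, while the guess
is assembled backwards from what the later steps consume. -/
theorem tracks_down {s : Finset ℕ} {f : ℕ → ℕ × Finset ℕ → ℕ × Finset ℕ} {N : ℕ}
    (h : ∀ c < N, Tracks s (f c)) : Tracks s (down f N) := by
  induction N with
  | zero => exact fun S hS => ⟨S, hS, fun y hy => ⟨y, hy, rfl⟩⟩
  | succ N ih =>
    intro S hS
    obtain ⟨S', hS', h1⟩ := h N (by omega) S hS
    obtain ⟨S'', hS'', h2⟩ := ih (fun c hc => h c (by omega)) S' hS'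
    refine ⟨S'', hS'', fun y hy => ?_⟩
    obtain ⟨x', hx', e'⟩ := h2 y hy
    obtain ⟨x, hx, e⟩ := h1 x' hx'
    exact ⟨x, hx, by rw [down, e, e']⟩

/-- If neither difference were contained in `s`, then `A` and `B`, which meet `S ⊆ s`, would violate
the condition for `s`. -/
theorem tracks_step {s A B : Finset ℕ} (h : ¬ Violates A B s) : Tracks s (step A B) := by
  intro S hS
  by_cases hv : Violates A B S
  swap
  · exact ⟨S, hS, fun y hy => ⟨y, hy, if_neg hv⟩⟩
  obtain ⟨⟨a, haA, haS⟩, ⟨b, hbB, hbS⟩, ⟨j, hjA, hjB, hjS⟩, ⟨l, hlB, hlA, hlS⟩⟩ := id hv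
  have key : B \ A ⊆ s ∨ A \ B ⊆ s := by
    by_contra! hc
    obtain ⟨h1, h2⟩ := hc
    obtain ⟨p, hp, hp'⟩ := Finset.not_subset.1 h1
    obtain ⟨q, hq, hq'⟩ := Finset.not_subset.1 h2
    rw [Finset.mem_sdiff] at hp hq
    exact h ⟨⟨a, haA, hS haS⟩, ⟨b, hbB, hS hbS⟩, ⟨q, hq.1, hq.2, hq'⟩, ⟨p, hp.1, hp.2, hp'⟩⟩
  -- Adding `D` leaves strictly fewer elements of `s` to be found, which makes room for one more bit
  -- `e` in the guess.
  have grow (D : Finset ℕ) (hD : D ⊆ s) (d : ℕ) (hd : d ∈ D) (hdS : d ∉ S) {y e : ℕ}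
      (he : e < 2) (hy : y < 2 ^ (s \ (S ∪ D)).card) : 2 * y + e < 2 ^ (s \ S).card := by
    have hlt : (s \ (S ∪ D)).card < (s \ S).card := by
      refine Finset.card_lt_card (Finset.ssubset_iff_subset_ne.2 ⟨?_, fun heq => ?_⟩)
      · exact Finset.sdiff_subset_sdiff subset_rfl Finset.subset_union_left
      · have : d ∈ s \ (S ∪ D) := heq ▸ Finset.mem_sdiff.2 ⟨hD hd, hdS⟩
        simp [hd] at this
    have := Nat.pow_le_pow_right (n := 2) (by norm_num) hlt
    rw [Nat.pow_succ] at this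
    omega
  rcases key with hD | hD
  · refine ⟨S ∪ B \ A, Finset.union_subset hS hD, fun y hy =>
      ⟨2 * y + 0, grow _ hD l (by simp [hlA, hlB]) hlS (by norm_num) hy, ?_⟩⟩
    simp [step, if_pos hv]
  · refine ⟨S ∪ A \ B, Finset.union_subset hS hD, fun y hy =>
      ⟨2 * y + 1, grow _ hD j (by simp [hjA, hjB]) hjS (by norm_num) hy, ?_⟩⟩
    simp [step, if_pos hv, Nat.add_mod, Nat.add_div]

theorem exists_run_subset {E : ℕ → Finset ℕ} {m : ℕ} {s : Finset ℕ} (hs : Nest E m s)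
    (n : ℕ) {v : ℕ} (hv : v ∈ s) : ∃ b < 2 ^ s.card, (run E n m v b).2 ⊆ s := by
  have : Tracks s (down (fun _ => pass E m) n) := tracks_down fun _ _ =>
    tracks_down fun i hi => tracks_down fun i' hi' => tracks_step (hs i hi i' hi')
  obtain ⟨S', hS', h⟩ := this {v} (by simpa)
  -- Leftover bits do not matter, and 0 is admissible whatever `S'` is.
  obtain ⟨x, hx, e⟩ := h 0 (by positivity)
  refine ⟨x, hx.trans_le (Nat.pow_le_pow_right (by norm_num) (Finset.card_le_card
    Finset.sdiff_subset)), ?_⟩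
  rw [run, e]
  exact hS'

end NestSearch
-- Memory layout, and the programs for a single pass.
namespace NestSearch

open RAM RAM.Prog

/-- The memory holds the characteristic vectors of `E 0`, …, `E (m - 1)` and of `S`, each of
length `n`, one after the other. -/
structure Mem (E : ℕ → Finset ℕ) (n m : ℕ) (S : Finset ℕ) (mem : ℕ → ℕ) : Prop where
  row : ∀ i < m, ∀ j < n, mem (i * n + j) = if j ∈ E i then 1 else 0
  cur : ∀ j < n, mem (m * n + j) = if j ∈ S then 1 else 0

/-- The registers below `6` hold the parameters of the search, and the memory holds the edges and
the current set. -/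
structure Env (E : ℕ → Finset ℕ) (n m k : ℕ) (S : Finset ℕ) (σ : State) : Prop where
  r0 : σ.reg 0 = n
  r1 : σ.reg 1 = m
  r2 : σ.reg 2 = k
  r3 : σ.reg 3 = 1
  r4 : σ.reg 4 = m * n
  r5 : σ.reg 5 = 2 ^ k
  mem : Mem E n m S σ.mem

section
variable {E : ℕ → Finset ℕ} {n m k : ℕ} {S : Finset ℕ} {σ τ : State}

theorem Env.of_agree {S' : Finset ℕ} (h : Env E n m k S σ) {b : ℕ} (hb : 6 ≤ b)
    (ha : Agree b σ τ) (hm : Mem E n m S' τ.mem) : Env E n m k S' τ where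
  r0 := (ha 0 (by omega)).trans h.r0
  r1 := (ha 1 (by omega)).trans h.r1
  r2 := (ha 2 (by omega)).trans h.r2
  r3 := (ha 3 (by omega)).trans h.r3
  r4 := (ha 4 (by omega)).trans h.r4
  r5 := (ha 5 (by omega)).trans h.r5
  mem := hm

theorem Mem.set {j a : ℕ} {S' : Finset ℕ} (h : Mem E n m S σ.mem) (_ : j < n)
    (ha : a = if j ∈ S' then 1 else 0) (hS : ∀ l < n, l ≠ j → (l ∈ S' ↔ l ∈ S)) :
    Mem E n m S' (σ.setMem (m * n + j) a).mem := by
  constructor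
  · intro i hi l hl
    have : (i + 1) * n ≤ m * n := Nat.mul_le_mul_right n hi
    rw [Nat.succ_mul] at this
    rw [State.mem_setMem, if_neg (by omega), h.row i hi l hl]
  · intro l hl
    rw [State.mem_setMem]
    by_cases hlj : l = j
    · rw [if_pos (by omega), ha, hlj]
    · rw [if_neg (by omega), h.cur l hl]
      simp only [hS l hl hlj]

theorem Mem.congr {S' : Finset ℕ} {mem : ℕ → ℕ} (h : Mem E n m S mem)
    (hS : ∀ l < n, (l ∈ S' ↔ l ∈ S)) : Mem E n m S' mem :=
  ⟨h.row, fun j hj => by rw [h.cur j hj]; simp only [hS j hj]⟩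

/-! ### Testing a pair of edges -/

/-- The body of the loop of `scan`. -/
def scanBody : Prog :=
  seq (sub 15 15 3) (seq (add 16 11 15) (seq (load 17 16) (seq (add 16 13 15) (seq (load 18 16)
    (seq (add 16 4 15) (seq (load 19 16)
      (ifNZ 19 (seq (add 20 20 17) (add 21 21 18))
        (seq (sub 16 17 18) (seq (add 22 22 16) (seq (sub 16 18 17) (add 23 23 16)))))))))))

/-- Count the vertices that witness the four conditions of `Violates` in registers `20` to `23`,
where registers `11` and `13` hold the addresses of the two edges. -/
def scan : Prog :=
  seq (const 20 0) (seq (const 21 0) (seq (const 22 0) (seq (const 23 0) (seq (copy 15 0)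
    (whileNZ 15 scanBody)))))

theorem wp_scan {i i' : ℕ} (h : Env E n m k S σ) (hi : i < m) (hi' : i' < m)
    (h11 : σ.reg 11 = i * n) (h13 : σ.reg 13 = i' * n) :
    wp scan (fun t τ => t ≤ 13 * n + 6 ∧ τ.mem = σ.mem ∧
      (τ.reg 20 ≠ 0 ↔ ∃ j < n, j ∈ E i ∧ j ∈ S) ∧
      (τ.reg 21 ≠ 0 ↔ ∃ j < n, j ∈ E i' ∧ j ∈ S) ∧
      (τ.reg 22 ≠ 0 ↔ ∃ j < n, j ∈ E i ∧ j ∉ E i' ∧ j ∉ S) ∧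
      (τ.reg 23 ≠ 0 ↔ ∃ j < n, j ∈ E i' ∧ j ∉ E i ∧ j ∉ S)) σ := by
  have peel (l : ℕ) (hl : l < n) (p : ℕ → Prop) :
      (∃ j < n, l ≤ j ∧ p j) ↔ p l ∨ ∃ j < n, l + 1 ≤ j ∧ p j := by
    constructor
    · rintro ⟨j, hj, hlj, hp⟩
      rcases hlj.eq_or_lt with rfl | hlj
      · exact .inl hp
      · exact .inr ⟨j, hj, hlj, hp⟩
    · rintro (hp | ⟨j, hj, hlj, hp⟩)
      · exact ⟨l, hl, le_rfl, hp⟩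
      · exact ⟨j, hj, by omega, hp⟩
  -- The counter runs down, so at value `l` the indices from `l` on have been examined. A round
  -- takes at most 12 steps, and its test one more.
  have loop := fun (ν : State) (hν : Agree 15 σ ν) => wp_whileNZ (σ := ν) (c := 15) (b := 15)
    (T := 13) (p := scanBody)
    (fun l τ => τ.reg 15 = l ∧ τ.mem = σ.mem ∧
      (τ.reg 20 ≠ 0 ↔ ∃ j < n, l ≤ j ∧ j ∈ E i ∧ j ∈ S) ∧
      (τ.reg 21 ≠ 0 ↔ ∃ j < n, l ≤ j ∧ j ∈ E i' ∧ j ∈ S) ∧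
      (τ.reg 22 ≠ 0 ↔ ∃ j < n, l ≤ j ∧ j ∈ E i ∧ j ∉ E i' ∧ j ∉ S) ∧
      (τ.reg 23 ≠ 0 ↔ ∃ j < n, l ≤ j ∧ j ∈ E i' ∧ j ∉ E i ∧ j ∉ S)) n
    (by simp [scanBody, Keeps]) (fun _ _ h => h.1) (by
      rintro l hl τ hτ ⟨h15, hm, h20, h21, h22, h23⟩
      have hτ := hν.trans hτ
      have e3 := (hτ 3 (by omega)).trans h.r3
      have e4 := (hτ 4 (by omega)).trans h.r4
      have e11 := (hτ 11 (by omega)).trans h11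
      have e13 := (hτ 13 (by omega)).trans h13
      simp only [peel l hl, ← h20, ← h21, ← h22, ← h23]
      -- Truncated subtraction of the two bits is the indicator of a set difference.
      by_cases hS : l ∈ S <;> by_cases hA : l ∈ E i <;> by_cases hB : l ∈ E i' <;>
        simp [scanBody, h15, hm, e3, e4, e11, e13, h.mem.row i hi l hl, h.mem.row i' hi' l hl,
          h.mem.cur l hl, hS, hA, hB])
  simp only [scan, wp_seq_iff, wp_const_iff, wp_copy_iff]
  refine (loop _ ?_ ?_).mono ?_
  · exact ((((Agree.setReg (by norm_num)).trans (.setReg (by norm_num))).trans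
      (.setReg (by norm_num))).trans (.setReg (by norm_num))).trans (.setReg (by norm_num))
  · simp [h.r0]
    refine ⟨?_, ?_, ?_, ?_⟩ <;> intros <;> omega
  · rintro t τ ⟨ht, -, -, hm, h'⟩
    exact ⟨by omega, hm, by simpa using h'⟩

/-! ### Extending the current set -/

/-- The body of the loop of `halve`. -/
def halveBody : Prog :=
  seq (sub 26 26 3) (ifNZ 25 (seq (const 25 0) (add 24 24 3)) (const 25 1))

/-- Divide the guess by two: the quotient goes to register `24`, the remainder to `25`. -/
def halve : Prog :=
  seq (const 24 0) (seq (const 25 0) (seq (copy 26 14) (whileNZ 26 halveBody)))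

/-- Quotient and remainder are counted up together, one round per unit of the guess. This is the
source of the second factor 2^k in the running time. -/
theorem wp_halve (h : σ.reg 3 = 1) :
    wp halve (fun t τ => t ≤ 5 * σ.reg 14 + 4 ∧ τ.mem = σ.mem ∧
      τ.reg 24 = σ.reg 14 / 2 ∧ τ.reg 25 = σ.reg 14 % 2) σ := by
  have loop := fun (ν : State) (hν : Agree 15 σ ν) => wp_whileNZ (σ := ν) (c := 26) (b := 15)
    (T := 5) (p := halveBody)
    (fun l τ => τ.reg 26 = l ∧ τ.mem = σ.mem ∧ l ≤ σ.reg 14 ∧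
      τ.reg 24 = (σ.reg 14 - l) / 2 ∧ τ.reg 25 = (σ.reg 14 - l) % 2) (σ.reg 14)
    (by simp [halveBody, Keeps]) (fun _ _ h => h.1) (by
      rintro l hl τ hτ ⟨h26, hm, hle, h24, h25⟩
      have e3 := ((hν.trans hτ) 3 (by omega)).trans h
      by_cases h0 : τ.reg 25 = 0
      · simp [halveBody, h26, hm, e3, h0, h24]
        omega
      · simp [halveBody, h26, hm, e3, h0, h24]
        omega)
  simp only [halve, wp_seq_iff, wp_const_iff, wp_copy_iff]
  refine (loop _ ?_ ?_).mono ?_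
  · exact ((Agree.setReg (by norm_num)).trans (.setReg (by norm_num))).trans
      (.setReg (by norm_num))
  · simp
  · rintro t τ ⟨ht, -, -, hm, -, h'⟩
    exact ⟨by omega, hm, by simpa using h'⟩

/-- The body of the loop of `insertDiff`. -/
def insertDiffBody : Prog :=
  seq (sub 15 15 3) (seq (add 16 27 15) (seq (load 17 16) (seq (add 16 28 15) (seq (load 18 16)
    (seq (sub 17 17 18) (ifNZ 17 (seq (add 16 4 15) (store 16 3)) skip))))))

/-- Add the difference of the edges with the addresses in registers `27` and `28` to the current
set. -/
def insertDiff : Prog :=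
  seq (copy 15 0) (whileNZ 15 insertDiffBody)

theorem wp_insertDiff {i i' : ℕ} (h : Env E n m k S σ) (hi : i < m) (hi' : i' < m)
    (h27 : σ.reg 27 = i * n) (h28 : σ.reg 28 = i' * n) :
    wp insertDiff (fun t τ => t ≤ 11 * n + 2 ∧ Mem E n m (S ∪ E i \ E i') τ.mem) σ := by
  have loop := fun (ν : State) (hν : Agree 15 σ ν) (h27 : ν.reg 27 = i * n)
      (h28 : ν.reg 28 = i' * n) => wp_whileNZ (σ := ν) (c := 15) (b := 15)
    (T := 11) (p := insertDiffBody)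
    -- Registers 27 and 28 lie above the frame bound 15, so the invariant has to carry them.
    (fun l τ => τ.reg 15 = l ∧ τ.reg 27 = i * n ∧ τ.reg 28 = i' * n ∧
      Mem E n m (S ∪ (E i \ E i').filter (l ≤ ·)) τ.mem) n
    (by simp [insertDiffBody, Keeps]) (fun _ _ h => h.1) (by
      rintro l hl τ hτ ⟨h15, h27, h28, hm⟩
      have hτ := hν.trans hτ
      have e3 := (hτ 3 (by omega)).trans h.r3
      have e4 := (hτ 4 (by omega)).trans h.r4
      have hne (j : ℕ) (hj : j ≠ l) : l ≤ j ↔ l + 1 ≤ j := by omega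
      by_cases hD : l ∈ E i ∧ l ∉ E i'
      · simp [insertDiffBody, h15, e3, e4, h27, h28, hm.row i hi l hl, hm.row i' hi' l hl, hD]
        refine Mem.set (σ := State.setReg _ _ _) hm hl (by simp [hD]) ?_
        intro j _ hj
        simp [hne j hj]
      · have hm' : Mem E n m (S ∪ (E i \ E i').filter (l ≤ ·)) τ.mem := by
          convert hm using 2
          ext j
          simp only [Finset.mem_filter, Finset.mem_sdiff]
          by_cases hj : j = l
          · subst hj; simp [hD]
          · rw [hne j hj]
        have hd : (if l ∈ E i then 1 else 0) - (if l ∈ E i' then 1 else 0) = 0 := by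
          split_ifs <;> simp_all
        simp [insertDiffBody, h15, e3, h27, h28, hm.row i hi l hl, hm.row i' hi' l hl, hd, hm'])
  simp only [insertDiff, wp_seq_iff, wp_copy_iff]
  refine (loop _ (.setReg (by norm_num)) (by simpa) (by simpa) ?_).mono ?_
  · simp only [State.reg_setReg, State.mem_setReg, if_true, h.r0, h27, h28]
    refine ⟨by simp, by simp, by simp, h.mem.congr fun l hl => ?_⟩
    simp; omega
  · rintro t τ ⟨ht, -, -, -, -, hm⟩
    exact ⟨by omega, by simpa using hm⟩

/-- Add one of the differences of the two edges to the current set. -/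
def extend : Prog :=
  seq halve (seq (copy 14 24) (seq
    (ifNZ 25 (seq (copy 27 11) (copy 28 13)) (seq (copy 27 13) (copy 28 11))) insertDiff))

theorem wp_extend {i i' : ℕ} (h : Env E n m k S σ) (hi : i < m) (hi' : i' < m)
    (h11 : σ.reg 11 = i * n) (h13 : σ.reg 13 = i' * n) (hx : σ.reg 14 ≤ 2 ^ k) :
    wp extend (fun t τ => t ≤ 11 * n + 5 * 2 ^ k + 10 ∧ τ.reg 14 = σ.reg 14 / 2 ∧
      Mem E n m (S ∪ if σ.reg 14 % 2 = 0 then E i' \ E i else E i \ E i') τ.mem) σ := by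
  rw [extend, wp_seq_iff]
  refine ((wp_halve h.r3).frame (b := 14) (by simp [halve, halveBody, Keeps])).mono ?_
  rintro t τ ⟨hτ, ht, hm, h24, h25⟩
  have hE : Env E n m k S τ := h.of_agree (by norm_num) hτ (hm ▸ h.mem)
  have e11 := (hτ 11 (by omega)).trans h11
  have e13 := (hτ 13 (by omega)).trans h13
  simp only [wp_seq_iff, wp_ifNZ_iff, wp_copy_iff]
  -- Register 25 holds the parity of the guess, so the two mixed cases are contradictory.
  split_ifs with h0 h1 h1
  · refine ((wp_insertDiff (E := E) (k := k) (S := S) (i := i') (i' := i) ?_ hi' hi (by simpa) (by simpa)).frame (b := 15)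
      (by simp [insertDiff, insertDiffBody, Keeps])).mono ?_
    · refine hE.of_agree (b := 14) (by norm_num) ?_ (by simpa using hE.mem)
      exact ((Agree.setReg (by norm_num)).trans (.setReg (by norm_num))).trans
        (.setReg (by norm_num))
    · rintro u ρ ⟨hρ, hu, hmu⟩
      refine ⟨by omega, ?_, hmu⟩
      rw [hρ 14 (by norm_num)]
      simpa using h24
  · simp at h0; omega
  · simp at h0; omega
  · refine ((wp_insertDiff (E := E) (k := k) (S := S) (i := i) (i' := i') ?_ hi hi' (by simpa) (by simpa)).frame (b := 15)
      (by simp [insertDiff, insertDiffBody, Keeps])).mono ?_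
    · refine hE.of_agree (b := 14) (by norm_num) ?_ (by simpa using hE.mem)
      exact ((Agree.setReg (by norm_num)).trans (.setReg (by norm_num))).trans
        (.setReg (by norm_num))
    · rintro u ρ ⟨hρ, hu, hmu⟩
      refine ⟨by omega, ?_, hmu⟩
      rw [hρ 14 (by norm_num)]
      simpa using h24

/-- The program for `step`. -/
def stepProg : Prog :=
  seq scan (ifNZ 20 (ifNZ 21 (ifNZ 22 (ifNZ 23 extend skip) skip) skip) skip)

/-- A bound on the running time of `stepProg`. -/
def stepTime (n k : ℕ) : ℕ := 24 * n + 5 * 2 ^ k + 20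

theorem keeps_stepProg : stepProg.Keeps 14 := by
  simp [stepProg, scan, scanBody, extend, halve, halveBody, insertDiff, insertDiffBody, Keeps]

theorem wp_stepProg (hE : ∀ i < m, E i ⊆ Finset.range n) {i i' : ℕ} {a : ℕ × Finset ℕ}
    (h : Env E n m k a.2 σ) (hi : i < m) (hi' : i' < m) (h11 : σ.reg 11 = i * n)
    (h13 : σ.reg 13 = i' * n) (h14 : σ.reg 14 = a.1) (hx : a.1 ≤ 2 ^ k) :
    wp stepProg (fun t τ => t ≤ stepTime n k ∧ τ.reg 14 = (step (E i) (E i') a).1 ∧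
      Mem E n m (step (E i) (E i') a).2 τ.mem) σ := by
  rw [stepProg, wp_seq_iff]
  refine ((wp_scan h hi hi' h11 h13).frame (b := 15) (by simp [scan, scanBody, Keeps])).mono ?_
  rintro t τ ⟨hτ, ht, hm, h20, h21, h22, h23⟩
  have del {i : ℕ} (hi : i < m) (p : ℕ → Prop) :
      (∃ j < n, j ∈ E i ∧ p j) ↔ ∃ j ∈ E i, p j :=
    ⟨fun ⟨j, _, h, h'⟩ => ⟨j, h, h'⟩,
      fun ⟨j, h, h'⟩ => ⟨j, Finset.mem_range.1 (hE i hi h), h, h'⟩⟩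
  rw [del hi] at h20 h22
  rw [del hi'] at h21 h23
  have hv : Violates (E i) (E i') a.2 ↔
      τ.reg 20 ≠ 0 ∧ τ.reg 21 ≠ 0 ∧ τ.reg 22 ≠ 0 ∧ τ.reg 23 ≠ 0 := by
    rw [h20, h21, h22, h23, Violates]
  have hτ14 := (hτ 14 (by omega)).trans h14
  by_cases hV : Violates (E i) (E i') a.2
  · obtain ⟨e20, e21, e22, e23⟩ := hv.1 hV
    simp only [wp_ifNZ_iff, if_neg e20, if_neg e21, if_neg e22, if_neg e23]
    refine (wp_extend (h.of_agree (by norm_num) hτ (hm ▸ h.mem)) hi hi'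
      ((hτ 11 (by omega)).trans h11) ((hτ 13 (by omega)).trans h13) (hτ14 ▸ hx)).mono ?_
    rintro u ρ ⟨hu, h1, h2⟩
    rw [step, if_pos hV, ← hτ14]
    -- `stepTime` is the sum of the bounds for `scan` and `extend` and of four tests.
    exact ⟨by unfold stepTime; omega, h1, h2⟩
  · rw [step_eq_self hV]
    have hm' := hm ▸ h.mem
    simp only [wp_ifNZ_iff, wp_skip_iff]
    unfold stepTime
    split_ifs with e20 e21 e22 e23
    all_goals first
      | exact ⟨by omega, hτ14, hm'⟩
      | exact absurd (hv.2 ⟨e20, e21, e22, e23⟩) hV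

/-! ### The passes -/

/-- The body of the inner loop of `passProg`. -/
def innerBody : Prog := seq (sub 12 12 3) (seq (sub 13 13 0) stepProg)

/-- The body of the outer loop of `passProg`. -/
def outerBody : Prog :=
  seq (sub 10 10 3) (seq (sub 11 11 0) (seq (copy 12 1) (seq (copy 13 4) (whileNZ 12 innerBody))))

/-- The program for `pass`. -/
def passProg : Prog := seq (copy 10 1) (seq (copy 11 4) (whileNZ 10 outerBody))

/-- A bound on the running time of `passProg`. -/
def passTime (n m k : ℕ) : ℕ := m * (m * (stepTime n k + 3) + 6) + 3

theorem keeps_innerBody : innerBody.Keeps 12 := by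
  have : stepProg.Keeps 12 := by
    simp [stepProg, scan, scanBody, extend, halve, halveBody, insertDiff, insertDiffBody, Keeps]
  simp [innerBody, Keeps, this]

theorem keeps_outerBody : outerBody.Keeps 10 := by
  simp [outerBody, innerBody, stepProg, scan, scanBody, extend, halve, halveBody, insertDiff,
    insertDiffBody, Keeps]

/-- The invariant describes the current pair `c` by its future: the remaining `l` steps take it to
the final result. By the recursion of `down` a round preserves this definitionally; the enclosing
loops use the same device. The bound on `c.1` is kept because halving takes time linear in the
guess. -/
theorem wp_inner (hE : ∀ i < m, E i ⊆ Finset.range n) {i : ℕ} {a : ℕ × Finset ℕ}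
    (h : Env E n m k a.2 σ) (hi : i < m) (h11 : σ.reg 11 = i * n) (h12 : σ.reg 12 = m)
    (h13 : σ.reg 13 = m * n) (h14 : σ.reg 14 = a.1) (hx : a.1 ≤ 2 ^ k) :
    wp (whileNZ 12 innerBody) (fun t τ => t ≤ m * (stepTime n k + 3) + 1 ∧ Agree 12 σ τ ∧
      τ.reg 14 = (down (fun i' => step (E i) (E i')) m a).1 ∧
      Mem E n m (down (fun i' => step (E i) (E i')) m a).2 τ.mem) σ := by
  refine (wp_whileNZ (T := stepTime n k + 3) (fun l τ => τ.reg 12 = l ∧ τ.reg 13 = l * n ∧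
    ∃ c : ℕ × Finset ℕ, τ.reg 14 = c.1 ∧ Mem E n m c.2 τ.mem ∧ c.1 ≤ 2 ^ k ∧
      down (fun i' => step (E i) (E i')) l c = down (fun i' => step (E i) (E i')) m a) m
    keeps_innerBody (fun _ _ h => h.1) ?_ ⟨h12, h13, a, h14, h.mem, hx, rfl⟩).mono ?_
  · rintro l hl τ hτ ⟨e12, e13, c, e14, hm, hc, hd⟩
    have e3 := (hτ 3 (by omega)).trans h.r3
    have e0 := (hτ 0 (by omega)).trans h.r0
    simp only [innerBody, wp_seq_iff, wp_sub_iff]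
    have hag : Agree 12 τ ((τ.setReg 12 (τ.reg 12 - τ.reg 3)).setReg 13
        (((τ.setReg 12 (τ.reg 12 - τ.reg 3)).reg 13) -
          ((τ.setReg 12 (τ.reg 12 - τ.reg 3)).reg 0))) :=
      (Agree.setReg (by norm_num)).trans (.setReg (by norm_num))
    refine ((wp_stepProg hE (i := i) (i' := l) (a := c)
      (h.of_agree (by norm_num) (hτ.trans hag) hm) hi hl ?_ ?_ (by simpa) hc).frame
      keeps_stepProg).mono ?_
    · rw [(hτ.trans hag) 11 (by omega), h11]
    · simp [e13, e0, Nat.succ_mul]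
    · rintro t ρ ⟨hρ, ht, f14, fm⟩
      refine ⟨by omega, ?_, ?_, _, f14, fm, (step_fst_le _ _ _).trans hc, hd⟩
      · rw [hρ 12 (by omega)]; simp [e12, e3]
      · rw [hρ 13 (by omega)]; simp [e13, e0, Nat.succ_mul]
  · rintro t τ ⟨ht, hτ, -, -, c, f14, fm, -, hd⟩
    rw [← hd]
    exact ⟨ht, hτ, f14, fm⟩

theorem down_fst_le {f : ℕ → ℕ × Finset ℕ → ℕ × Finset ℕ} {N : ℕ}
    (h : ∀ c < N, ∀ a, (f c a).1 ≤ a.1) (a : ℕ × Finset ℕ) : (down f N a).1 ≤ a.1 :=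
  down_induction (fun a b : ℕ × Finset ℕ => b.1 ≤ a.1) (fun _ => le_rfl)
    (fun _ _ _ h h' => h'.trans h) h a

theorem wp_passProg (hE : ∀ i < m, E i ⊆ Finset.range n) {a : ℕ × Finset ℕ}
    (h : Env E n m k a.2 σ) (h14 : σ.reg 14 = a.1) (hx : a.1 ≤ 2 ^ k) :
    wp passProg (fun t τ => t ≤ passTime n m k ∧ Agree 10 σ τ ∧ τ.reg 14 = (pass E m a).1 ∧
      Mem E n m (pass E m a).2 τ.mem) σ := by
  simp only [passProg, wp_seq_iff, wp_copy_iff]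
  have hag : Agree 10 σ ((σ.setReg 10 (σ.reg 1)).setReg 11 ((σ.setReg 10 (σ.reg 1)).reg 4)) :=
    (Agree.setReg (by norm_num)).trans (.setReg (by norm_num))
  refine (wp_whileNZ (T := m * (stepTime n k + 3) + 6) (fun l τ =>
    τ.reg 10 = l ∧ τ.reg 11 = l * n ∧
    ∃ c : ℕ × Finset ℕ, τ.reg 14 = c.1 ∧ Mem E n m c.2 τ.mem ∧ c.1 ≤ 2 ^ k ∧
      down (fun i => down (fun i' => step (E i) (E i')) m) l c = pass E m a) m
    keeps_outerBody (fun _ _ h => h.1) ?_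
    ⟨?_, ?_, a, ?_, ?_, hx, rfl⟩).mono ?_
  · rintro l hl τ hτ ⟨e10, e11, c, e14, hm, hc, hd⟩
    have hE' := h.of_agree (by norm_num) (hag.trans hτ) hm
    simp only [outerBody, wp_seq_iff, wp_sub_iff, wp_copy_iff]
    refine (wp_inner hE (i := l) (a := c)
      (hE'.of_agree (b := 10) (by norm_num) ?_ ?_) hl ?_ ?_ ?_ ?_ hc).mono ?_
    · exact (((Agree.setReg (by norm_num)).trans (.setReg (by norm_num))).trans
        (.setReg (by norm_num))).trans (.setReg (by norm_num))
    · exact hm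
    · simp [e11, hE'.r0, Nat.succ_mul]
    · simp [hE'.r1]
    · simp [hE'.r4]
    · simpa
    · rintro t ρ ⟨ht, hρ, f14, fm⟩
      refine ⟨by omega, ?_, ?_, _, f14, fm,
        (down_fst_le (fun _ _ _ => step_fst_le _ _ _) _).trans hc, hd⟩
      · rw [hρ 10 (by omega)]; simp [e10, hE'.r3]
      · rw [hρ 11 (by omega)]; simp [e11, hE'.r0, Nat.succ_mul]
  · simp [h.r1]
  · simp [h.r4]
  · simpa
  · exact h.mem
  · rintro t τ ⟨ht, hτ, -, -, c, f14, fm, -, hd⟩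
    rw [← hd]
    exact ⟨by unfold passTime; omega, hag.trans hτ, f14, fm⟩

end
end NestSearch
namespace NestSearch

open RAM RAM.Prog

section
variable {E : ℕ → Finset ℕ} {n m k : ℕ} {S : Finset ℕ} {σ τ : State}

/-! ### The search for one guess -/

/-- The body of the loop of `clear`. -/
def clearBody : Prog :=
  seq (sub 15 15 3) (seq (add 16 4 15) (seq (const 17 0) (store 16 17)))

/-- Make the current set empty. -/
def clear : Prog := seq (copy 15 0) (whileNZ 15 clearBody)

theorem wp_clear (h : Env E n m k S σ) :
    wp clear (fun t τ => t ≤ 5 * n + 2 ∧ Mem E n m ∅ τ.mem) σ := by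
  simp only [clear, wp_seq_iff, wp_copy_iff]
  refine (wp_whileNZ (b := 15) (T := 5)
    (fun l τ => τ.reg 15 = l ∧ Mem E n m (S.filter (· < l)) τ.mem) n
    (by simp [clearBody, Keeps]) (fun _ _ h => h.1) ?_ ⟨?_, ?_⟩).mono ?_
  · rintro l hl τ hτ ⟨h15, hm⟩
    have hτ := (Agree.setReg (by norm_num)).trans hτ
    have e3 := (hτ 3 (by omega)).trans h.r3
    have e4 := (hτ 4 (by omega)).trans h.r4
    simp [clearBody, h15, e3, e4]
    refine Mem.set (σ := State.setReg _ _ _) hm hl (by simp) fun j _ hj => ?_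
    simp only [Finset.mem_filter]
    exact and_congr_right fun _ => by omega
  · simp [h.r0]
  · refine h.mem.congr fun l hl => ?_
    simp [hl]
  · rintro t τ ⟨ht, -, -, hm⟩
    exact ⟨by omega, by simpa using hm⟩

/-- The body of the loop of `searchProg`. -/
def searchBody : Prog := seq (sub 9 9 3) passProg

/-- The program for `run`: register `7` holds the starting vertex, and `8` the guess. -/
def searchProg : Prog :=
  seq clear (seq (add 16 4 7) (seq (store 16 3) (seq (copy 14 8) (seq (copy 9 0)
    (whileNZ 9 searchBody)))))

/-- A bound on the running time of `searchProg`. -/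
def searchTime (n m k : ℕ) : ℕ := n * (passTime n m k + 7) + 7

theorem keeps_passProg : passProg.Keeps 10 := by
  simpa [passProg, Keeps] using keeps_outerBody

theorem _root_.RAM.Prog.Keeps.mono {b c : ℕ} {p : Prog} (hbc : b ≤ c) (h : p.Keeps c) : p.Keeps b := by
  induction p with
  | skip | store => trivial
  | const | copy | add | sub | load => exact hbc.trans h
  | seq _ _ ih ih' | ifNZ _ _ _ ih ih' => exact ⟨ih h.1, ih' h.2⟩
  | whileNZ _ _ ih => exact ih h

theorem keeps_searchBody : searchBody.Keeps 9 := by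
  simpa [searchBody, Keeps] using Keeps.mono (by norm_num) keeps_passProg

theorem keeps_searchProg : searchProg.Keeps 9 := by
  simpa [searchProg, clear, clearBody, Keeps] using keeps_searchBody

theorem wp_searchProg (hE : ∀ i < m, E i ⊆ Finset.range n) {v b : ℕ} (h : Env E n m k S σ)
    (hv : v < n) (hb : b ≤ 2 ^ k) (h7 : σ.reg 7 = v) (h8 : σ.reg 8 = b) :
    wp searchProg (fun t τ => t ≤ searchTime n m k ∧ Mem E n m (run E n m v b).2 τ.mem) σ := by
  rw [searchProg, wp_seq_iff]
  refine ((wp_clear h).frame (b := 15) (by simp [clear, clearBody, Keeps])).mono ?_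
  rintro t₁ σ₁ ⟨hσ₁, ht₁, hm₁⟩
  have h₁ := h.of_agree (by norm_num) hσ₁ hm₁
  have h7 := (hσ₁ 7 (by omega)).trans h7
  have h8 := (hσ₁ 8 (by omega)).trans h8
  simp only [wp_seq_iff, wp_add_iff, wp_store_iff, wp_copy_iff]
  have hm₂ := Mem.set (σ := σ₁.setReg 16 (m * n + v)) (a := 1) (S' := {v}) hm₁ hv (by simp)
    (fun l _ hl => by simp [hl])
  have e16 : σ₁.reg 4 + σ₁.reg 7 = m * n + v := by rw [h₁.r4, h7]
  have e3 : (σ₁.setReg 16 (m * n + v)).reg 3 = 1 := by simp [h₁.r3]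
  have e16' : (σ₁.setReg 16 (m * n + v)).reg 16 = m * n + v := by simp
  rw [e16, e3, e16']
  have hag : Agree 9 σ₁ (((((σ₁.setReg 16 (m * n + v)).setMem (m * n + v) 1).setReg 14
      (((σ₁.setReg 16 (m * n + v)).setMem (m * n + v) 1).reg 8))).setReg 9
      ((((σ₁.setReg 16 (m * n + v)).setMem (m * n + v) 1).setReg 14
      (((σ₁.setReg 16 (m * n + v)).setMem (m * n + v) 1).reg 8)).reg 0)) := by
    refine Agree.trans ?_ (.setReg (by norm_num))
    refine Agree.trans ?_ (.setReg (by norm_num))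
    exact Agree.setReg (σ := σ₁) (by norm_num)
  refine (wp_whileNZ (T := passTime n m k + 2) (fun l τ => τ.reg 9 = l ∧
    ∃ c : ℕ × Finset ℕ, τ.reg 14 = c.1 ∧ Mem E n m c.2 τ.mem ∧ c.1 ≤ 2 ^ k ∧
      down (fun _ => pass E m) l c = run E n m v b) n
    keeps_searchBody (fun _ _ h => h.1) ?_ ⟨?_, (b, {v}), ?_, ?_, hb, rfl⟩).mono ?_
  · rintro l hl τ hτ ⟨e9, c, e14, hm, hc, hd⟩
    have hE' := h₁.of_agree (by norm_num) (hag.trans hτ) hm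
    simp only [searchBody, wp_seq_iff, wp_sub_iff]
    refine (wp_passProg hE (a := c)
      (hE'.of_agree (b := 9) (by norm_num) ?_ ?_) ?_ hc).mono ?_
    · exact .setReg (by norm_num)
    · exact hm
    · simpa
    rintro t ρ ⟨ht, hρ, f14, fm⟩
    refine ⟨by omega, ?_, _, f14, fm, (down_fst_le (fun _ _ _ =>
      down_fst_le (fun _ _ _ => step_fst_le _ _ _) _) _).trans hc, hd⟩
    rw [hρ 9 (by omega)]; simp [e9, hE'.r3]
  · simp [h₁.r0]
  · simp [h8]
  · exact hm₂
  · rintro t τ ⟨ht, hτ, -, c, f14, fm, -, hd⟩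
    rw [← hd]
    refine ⟨?_, fm⟩
    -- The `5 * n` steps of `clear` are charged to the `n` passes.
    have : n * (passTime n m k + 7) = n * (passTime n m k + 2) + 5 * n := by ring
    unfold searchTime
    omega

/-- The body of the loop of `count`. -/
def countBody : Prog :=
  seq (sub 15 15 3) (seq (add 16 4 15) (seq (load 17 16) (add 18 18 17)))

/-- Count the elements of the current set. -/
def count : Prog := seq (const 18 0) (seq (copy 15 0) (whileNZ 15 countBody))

theorem wp_count (h : Env E n m k S σ) (hS : S ⊆ Finset.range n) :
    wp count (fun t τ => t ≤ 5 * n + 3 ∧ τ.mem = σ.mem ∧ τ.reg 18 = S.card) σ := by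
  simp only [count, wp_seq_iff, wp_const_iff, wp_copy_iff]
  refine (wp_whileNZ (b := 15) (T := 5)
    (fun l τ => τ.reg 15 = l ∧ τ.mem = σ.mem ∧ τ.reg 18 = (S.filter (l ≤ ·)).card) n
    (by simp [countBody, Keeps]) (fun _ _ h => h.1) ?_ ⟨?_, ?_, ?_⟩).mono ?_
  · rintro l hl τ hτ ⟨h15, hm, h18⟩
    have hτ := ((Agree.setReg (by norm_num)).trans (.setReg (by norm_num))).trans hτ
    have e3 := (hτ 3 (by omega)).trans h.r3
    have e4 := (hτ 4 (by omega)).trans h.r4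
    simp [countBody, h15, e3, e4, hm, h.mem.cur l hl, h18]
    split_ifs with hlS
    · rw [← Finset.card_insert_of_notMem (a := l) (by simp)]
      congr 1
      ext j
      simp only [Finset.mem_insert, Finset.mem_filter]
      constructor
      · rintro (rfl | ⟨h1, h2⟩)
        · exact ⟨hlS, le_rfl⟩
        · exact ⟨h1, by omega⟩
      · rintro ⟨h1, h2⟩
        rcases h2.eq_or_lt with rfl | h2
        · exact .inl rfl
        · exact .inr ⟨h1, h2⟩
    · rw [add_zero]
      congr 1
      ext j
      simp only [Finset.mem_filter, and_congr_right_iff]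
      intro hj
      have : j ≠ l := fun h => hlS (h ▸ hj)
      omega
  · simp [h.r0]
  · rfl
  · simp only [State.reg_setReg]
    symm
    rw [if_neg (by norm_num), if_pos trivial, Finset.card_eq_zero, Finset.filter_eq_empty_iff]
    intro j hj
    have := Finset.mem_range.1 (hS hj)
    omega
  · rintro t τ ⟨ht, -, -, hm, h18⟩
    exact ⟨by omega, hm, by simpa using h18⟩

/-- Search with the starting vertex in register `7` and the guess in register `8`, and set register
`6` to `1` if the nest-set that is found has at most `k` elements. -/
def tryProg : Prog :=
  seq searchProg (seq count (seq (sub 18 18 2) (ifNZ 18 skip (const 6 1))))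

/-- A bound on the running time of `tryProg`. -/
def tryTime (n m k : ℕ) : ℕ := n * (passTime n m k + 12) + 15

theorem wp_tryProg (hE : ∀ i < m, E i ⊆ Finset.range n) {v b : ℕ} (h : Env E n m k S σ)
    (hv : v < n) (hb : b ≤ 2 ^ k) (h7 : σ.reg 7 = v) (h8 : σ.reg 8 = b) :
    wp tryProg (fun t τ => t ≤ tryTime n m k ∧ Env E n m k (run E n m v b).2 τ ∧ τ.reg 7 = v ∧
      τ.reg 8 = b ∧ τ.reg 6 = if (run E n m v b).2.card ≤ k then 1 else σ.reg 6) σ := by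
  rw [tryProg, wp_seq_iff]
  refine ((wp_searchProg hE h hv hb h7 h8).frame keeps_searchProg).mono ?_
  rintro t₁ σ₁ ⟨hσ₁, ht₁, hm₁⟩
  have h₁ := h.of_agree (by norm_num) hσ₁ hm₁
  rw [wp_seq_iff]
  refine ((wp_count h₁ (run_subset hE hv)).frame (b := 15)
    (by simp [count, countBody, Keeps])).mono ?_
  rintro t₂ σ₂ ⟨hσ₂, ht₂, hm₂, h18⟩
  have h₂ := h₁.of_agree (by norm_num) hσ₂ (hm₂ ▸ hm₁)
  have e6 := (hσ₂ 6 (by omega)).trans (hσ₁ 6 (by omega))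
  have e7 := ((hσ₂ 7 (by omega)).trans (hσ₁ 7 (by omega))).trans h7
  have e8 := ((hσ₂ 8 (by omega)).trans (hσ₁ 8 (by omega))).trans h8
  have htime : n * (passTime n m k + 12) = n * (passTime n m k + 7) + 5 * n := by ring
  unfold searchTime at ht₁
  unfold tryTime
  simp only [wp_seq_iff, wp_sub_iff, wp_ifNZ_iff, wp_skip_iff, wp_const_iff]
  rw [State.reg_setReg, if_pos rfl, h18, h₂.r2]
  -- The truncated difference in register 18 vanishes exactly in the first case.
  by_cases hk : (run E n m v b).2.card ≤ k
  · rw [if_pos (by omega), if_pos hk]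
    refine ⟨by omega, ?_, by simpa, by simpa, by simp⟩
    refine h₂.of_agree le_rfl ?_ h₂.mem
    exact (Agree.setReg (by norm_num)).trans (.setReg (by norm_num))
  · rw [if_neg (by omega), if_neg hk]
    refine ⟨by omega, ?_, by simpa, by simpa, by simpa⟩
    exact h₂.of_agree le_rfl (.setReg (by norm_num)) h₂.mem

/-! ### The whole search -/

/-- `S` is a set of at most `k` numbers below `n` that satisfies the nest-set condition. -/
structure Solution (E : ℕ → Finset ℕ) (n m k : ℕ) (S : Finset ℕ) : Prop where
  nonempty : S.Nonempty
  subset : S ⊆ Finset.range n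
  nest : Nest E m S
  card_le : S.card ≤ k

/-- From a solution, take any of its vertices and the guess that keeps the run inside it; the set
found may be smaller. Conversely, every run yields a nest-set, so only its size has to be checked.
-/
theorem exists_solution_iff (hE : ∀ i < m, E i ⊆ Finset.range n) :
    (∃ S, Solution E n m k S) ↔ ∃ v < n, ∃ b < 2 ^ k, (run E n m v b).2.card ≤ k := by
  constructor
  · rintro ⟨S, ⟨v, hv⟩, hS, hn, hk⟩
    obtain ⟨b, hb, hr⟩ := exists_run_subset hn n hv
    exact ⟨v, Finset.mem_range.1 (hS hv), b,
      hb.trans_le (Nat.pow_le_pow_right (by norm_num) hk), (Finset.card_le_card hr).trans hk⟩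
  · rintro ⟨v, hv, b, -, hk⟩
    exact ⟨_, ⟨v, mem_run E n m v b⟩, run_subset hE hv, nest_run hE hv, hk⟩

/-- The body of the inner loop of `searchAll`. -/
def guessBody : Prog := seq (sub 8 8 3) (ifNZ 6 skip tryProg)

/-- The body of the outer loop of `searchAll`. -/
def vertexBody : Prog := seq (sub 7 7 3) (seq (copy 8 5) (whileNZ 8 guessBody))

/-- Try all starting vertices and all guesses. -/
def searchAll : Prog := seq (copy 7 0) (whileNZ 7 vertexBody)

theorem keeps_guessBody : guessBody.Keeps 6 := by
  simpa [guessBody, tryProg, count, countBody, Keeps] using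
    Keeps.mono (by norm_num) keeps_searchProg

/-- Either a solution has been found, or there is none among the combinations `F` of a starting
vertex and a guess that have been tried so far. -/
def Progress (E : ℕ → Finset ℕ) (n m k : ℕ) (F : ℕ → ℕ → Prop) (σ : State) : Prop :=
  ∃ S, Env E n m k S σ ∧ ((σ.reg 6 = 1 ∧ Solution E n m k S) ∨
    (σ.reg 6 = 0 ∧ ∀ v < n, ∀ b < 2 ^ k, F v b → k < (run E n m v b).2.card))

theorem Progress.mono {F F' : ℕ → ℕ → Prop} (h : Progress E n m k F σ) (hσ : Agree 7 σ τ)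
    (hm : τ.mem = σ.mem) (hF : ∀ v < n, ∀ b < 2 ^ k, F' v b → F v b) :
    Progress E n m k F' τ := by
  obtain ⟨S, hS, h⟩ := h
  refine ⟨S, hS.of_agree (by norm_num) hσ (hm ▸ hS.mem), ?_⟩
  rw [hσ 6 (by norm_num)]
  exact h.imp_right fun h => ⟨h.1, fun v hv b hb hf => h.2 v hv b hb (hF v hv b hb hf)⟩

theorem wp_guesses (hE : ∀ i < m, E i ⊆ Finset.range n) {v : ℕ} (hv : v < n)
    (h : Progress E n m k (fun v' _ => v < v') σ) (h7 : σ.reg 7 = v) (h8 : σ.reg 8 = 2 ^ k) :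
    wp (whileNZ 8 guessBody) (fun t τ => t ≤ 2 ^ k * (tryTime n m k + 3) + 1 ∧ τ.reg 7 = v ∧
      Progress E n m k (fun v' _ => v ≤ v') τ) σ := by
  refine (wp_whileNZ (T := tryTime n m k + 3) (fun l τ => τ.reg 8 = l ∧ τ.reg 7 = v ∧
    -- Both loops count down, so the combinations already tried form a final segment of the
    -- lexicographic order.
    Progress E n m k (fun v' b => v < v' ∨ v = v' ∧ l ≤ b) τ) (2 ^ k)
    keeps_guessBody (fun _ _ h => h.1) ?_
    ⟨h8, h7, h.mono (.refl _ _) rfl ?_⟩).mono ?_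
  · rintro l hl τ hτ ⟨e8, e7, S, hS, hp⟩
    simp only [guessBody, wp_seq_iff, wp_sub_iff, wp_ifNZ_iff, wp_skip_iff]
    have hag : Agree 8 τ (τ.setReg 8 (τ.reg 8 - τ.reg 3)) := .setReg (by norm_num)
    have hS' := hS.of_agree (b := 8) (by norm_num) hag hS.mem
    have f8 : (τ.setReg 8 (τ.reg 8 - τ.reg 3)).reg 8 = l := by simp [e8, hS.r3]
    rw [hag 6 (by norm_num)]
    rcases hp with ⟨h6, hs⟩ | ⟨h6, hs⟩
    -- After a success the remaining rounds are idle, so the solution stays in memory.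
    · rw [h6, if_neg one_ne_zero]
      refine ⟨by unfold tryTime; omega, f8, by simpa, S, hS', .inl ⟨by simpa, hs⟩⟩
    · rw [h6, if_pos rfl]
      refine (wp_tryProg hE hS' hv hl.le (by simpa) f8).mono ?_
      rintro t ρ ⟨ht, hρ, r7, r8, r6⟩
      refine ⟨by omega, r8, r7, _, hρ, ?_⟩
      rw [r6]
      by_cases hk : (run E n m v l).2.card ≤ k
      · exact .inl ⟨if_pos hk, ⟨v, mem_run E n m v l⟩, run_subset hE hv, nest_run hE hv, hk⟩
      · refine .inr ⟨by rw [if_neg hk, hag 6 (by norm_num), h6], fun v' hv' b hb hf => ?_⟩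
        by_cases hvb : v' = v ∧ b = l
        · rw [hvb.1, hvb.2]; omega
        · exact hs v' hv' b hb (by omega)
  · intro v' _ b hb
    omega
  · rintro t τ ⟨ht, -, -, h7, hp⟩
    exact ⟨ht, h7, hp.mono (.refl _ _) rfl fun v' _ b _ => by omega⟩

theorem wp_searchAll (hE : ∀ i < m, E i ⊆ Finset.range n) (h : Env E n m k S σ)
    (h6 : σ.reg 6 = 0) :
    wp searchAll (fun t τ => t ≤ n * (2 ^ k * (tryTime n m k + 3) + 4) + 2 ∧
      ∃ S, Env E n m k S τ ∧ ((τ.reg 6 = 1 ∧ Solution E n m k S) ∨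
        (τ.reg 6 = 0 ∧ ¬ ∃ S, Solution E n m k S))) σ := by
  simp only [searchAll, wp_seq_iff, wp_copy_iff]
  refine (wp_whileNZ (T := 2 ^ k * (tryTime n m k + 3) + 4) (b := 6) (fun l τ => τ.reg 7 = l ∧
    Progress E n m k (fun v _ => l ≤ v) τ) n ?_ (fun _ _ h => h.1) ?_ ⟨?_, S, ?_, ?_⟩).mono ?_
  · simpa [vertexBody, Keeps] using keeps_guessBody
  · rintro l hl τ hτ ⟨e7, hp⟩
    simp only [vertexBody, wp_seq_iff, wp_sub_iff, wp_copy_iff]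
    obtain ⟨S', hS', -⟩ := id hp
    refine (wp_guesses hE hl (hp.mono ?_ ?_ fun v' _ b _ => by omega) ?_ ?_).mono ?_
    · exact (Agree.setReg (by norm_num)).trans (.setReg (by norm_num))
    · rfl
    · simp [e7, hS'.r3]
    · simp [hS'.r5]
    · rintro t ρ ⟨ht, h7, hp⟩
      exact ⟨by omega, h7, hp⟩
  · simp [h.r0]
  · exact h.of_agree (b := 6) le_rfl (.setReg (by norm_num)) h.mem
  · exact .inr ⟨by simpa, fun v hv b _ hf => by omega⟩
  · rintro t τ ⟨ht, -, -, S, hS, hp⟩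
    refine ⟨by omega, S, hS, hp.imp_right fun hp => ⟨hp.1, ?_⟩⟩
    rw [exists_solution_iff hE]
    rintro ⟨v, hv, b, hb, hk⟩
    have := hp.2 v hv b hb (Nat.zero_le v)
    omega

/-! ### The complete program and its running time. -/

/-- Compute `m * n` and `2 ^ k`. -/
def init : Prog :=
  seq (const 3 1) (seq (copy 15 1) (seq (whileNZ 15 (seq (sub 15 15 3) (add 4 4 0)))
    (seq (const 5 1) (seq (copy 15 2) (whileNZ 15 (seq (sub 15 15 3) (add 5 5 5)))))))

theorem wp_init (h0 : σ.reg 0 = n) (h1 : σ.reg 1 = m) (h2 : σ.reg 2 = k) (h4 : σ.reg 4 = 0)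
    (hm : Mem E n m S σ.mem) :
    wp init (fun t τ => t ≤ 3 * m + 3 * k + 6 ∧ Env E n m k S τ ∧ τ.reg 6 = σ.reg 6) σ := by
  simp only [init, wp_seq_iff, wp_copy_iff, wp_const_iff]
  refine (wp_whileNZ (T := 3) (b := 3) (fun l τ => τ.reg 15 = l ∧ τ.reg 3 = 1 ∧
    τ.reg 4 + l * n = m * n ∧ τ.reg 6 = σ.reg 6 ∧ τ.mem = σ.mem) m (by simp [Keeps])
    (fun _ _ h => h.1) ?_ ?_).mono ?_
  · rintro l hl τ hτ ⟨e15, e3, e4, e6, em⟩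
    have e0 := hτ 0 (by norm_num)
    simp [h0] at e0
    simp [e15, e3, e6, em, e0]
    rw [← e4]; ring
  · simp [h1, h4]
  rintro t₁ σ₁ ⟨ht₁, hσ₁, -, e3, e4, e6, em⟩
  have e0 := hσ₁ 0 (by norm_num)
  have e1 := hσ₁ 1 (by norm_num)
  have e2 := hσ₁ 2 (by norm_num)
  simp [h0, h1, h2] at e0 e1 e2 e4
  refine (wp_whileNZ (T := 3) (b := 5) (fun l τ => τ.reg 15 = l ∧
    τ.reg 5 * 2 ^ l = 2 ^ k ∧ τ.reg 6 = σ.reg 6 ∧ τ.mem = σ.mem) k (by simp [Keeps])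
    (fun _ _ h => h.1) ?_ ?_).mono ?_
  · rintro l hl τ hτ ⟨e15, e5, e6, em⟩
    have f3 := hτ 3 (by norm_num)
    simp [e3] at f3
    simp [e15, f3, e6, em]
    rw [← e5]; ring
  · simp [e2, e6, em]
  rintro t₂ σ₂ ⟨ht₂, hσ₂, -, f5, f6, fm⟩
  have f0 := hσ₂ 0 (by norm_num)
  have f1 := hσ₂ 1 (by norm_num)
  have f2 := hσ₂ 2 (by norm_num)
  have f3 := hσ₂ 3 (by norm_num)
  have f4 := hσ₂ 4 (by norm_num)
  simp at f0 f1 f2 f3 f4 f5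
  exact ⟨by omega, ⟨f0.trans e0, f1.trans e1, f2.trans e2, f3.trans e3, f4.trans e4, f5,
    fm ▸ hm⟩, f6⟩

/-- The program that computes nest-sets. -/
def prog : Prog := seq init (seq searchAll (seq (copy 0 6) (copy 1 4)))

/-- A bound on the running time of `prog`. -/
def time (n m k : ℕ) : ℕ := n * (2 ^ k * (tryTime n m k + 3) + 4) + 3 * m + 3 * k + 10

theorem wp_prog (hE : ∀ i < m, E i ⊆ Finset.range n) (h0 : σ.reg 0 = n) (h1 : σ.reg 1 = m)
    (h2 : σ.reg 2 = k) (h4 : σ.reg 4 = 0) (h6 : σ.reg 6 = 0) (hm : Mem E n m S σ.mem) :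
    wp prog (fun t τ => t ≤ time n m k ∧
      ((∃ S, Solution E n m k S ∧ τ.reg 0 = 1 ∧ Mem E n m S (τ.mem) ∧ τ.reg 1 = m * n) ∨
        (τ.reg 0 = 0 ∧ ¬ ∃ S, Solution E n m k S))) σ := by
  rw [prog, wp_seq_iff]
  refine (wp_init h0 h1 h2 h4 hm).mono ?_
  rintro t₁ σ₁ ⟨ht₁, hσ₁, h6'⟩
  rw [wp_seq_iff]
  refine (wp_searchAll hE hσ₁ (h6'.trans h6)).mono ?_
  rintro t₂ σ₂ ⟨ht₂, S', hS', hp⟩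
  simp only [wp_seq_iff, wp_copy_iff]
  refine ⟨by unfold time; omega, ?_⟩
  rcases hp with ⟨r6, hs⟩ | ⟨r6, hs⟩
  · exact .inl ⟨S', hs, by simpa, hS'.mem, by simp [hS'.r4]⟩
  · exact .inr ⟨by simpa, hs⟩

/-- With `W = 2 ^ k` and `A = n + m + 1`, each nested layer is bounded by a constant times one
monomial in `W` and `A`. The five factors `A` come from starting vertices, passes, the two edges of
a pair, and the vertices scanned; the factors `W` come from the guesses and from halving. -/
theorem time_le (n m k : ℕ) : time n m k ≤ 2 ^ (2 * k) * (120 * (n + m + 1) ^ 5) := by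
  have hW : 1 ≤ 2 ^ k := Nat.one_le_two_pow
  have hk : k ≤ 2 ^ k := Nat.lt_two_pow_self.le
  rw [mul_comm 2 k, pow_mul]
  unfold time tryTime passTime stepTime
  generalize 2 ^ k = W at *
  generalize hA : n + m + 1 = A
  have hn : n ≤ A := by omega
  have hm : m ≤ A := by omega
  have hA1 : 1 ≤ A := by omega
  have hWA : ∀ i, 1 ≤ W * A ^ i := fun i => Nat.mul_pos hW (pow_pos hA1 i)
  have hAi : ∀ i, A ^ i ≤ W * A ^ i := fun i => Nat.le_mul_of_pos_left _ hW
  have h1 : 24 * n + 5 * W + 20 ≤ 49 * (W * A) := by nlinarith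
  have h2 : m * (24 * n + 5 * W + 20 + 3) + 6 ≤ 58 * (W * A ^ 2) := by
    have : m * (24 * n + 5 * W + 20 + 3) ≤ A * (52 * (W * A)) := by
      refine Nat.mul_le_mul hm ?_
      have := hWA 1
      rw [pow_one] at this
      omega
    have := hWA 2
    nlinarith
  have h3 : m * (m * (24 * n + 5 * W + 20 + 3) + 6) + 3 ≤ 61 * (W * A ^ 3) := by
    have := Nat.mul_le_mul hm h2
    have := hWA 3
    nlinarith
  have h4 : n * (m * (m * (24 * n + 5 * W + 20 + 3) + 6) + 3 + 12) + 15 ≤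
      88 * (W * A ^ 4) := by
    have : n * (m * (m * (24 * n + 5 * W + 20 + 3) + 6) + 3 + 12) ≤ A * (73 * (W * A ^ 3)) :=
      Nat.mul_le_mul hn (by have := hWA 3; omega)
    have := hWA 4
    nlinarith
  generalize n * (m * (m * (24 * n + 5 * W + 20 + 3) + 6) + 3 + 12) + 15 = Z at *
  have h5 : W * (Z + 3) + 4 ≤ 95 * (W ^ 2 * A ^ 4) := by
    have : W * (Z + 3) ≤ W * (91 * (W * A ^ 4)) :=
      Nat.mul_le_mul le_rfl (by have := hWA 4; omega)
    have : 1 ≤ W ^ 2 * A ^ 4 := Nat.mul_pos (pow_pos hW 2) (pow_pos hA1 4)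
    nlinarith
  have h6 : n * (W * (Z + 3) + 4) ≤ A * (95 * (W ^ 2 * A ^ 4)) := Nat.mul_le_mul hn h5
  have h7 : 1 ≤ W ^ 2 * A ^ 5 := Nat.mul_pos (pow_pos hW 2) (pow_pos hA1 5)
  have h8 : A ≤ W ^ 2 * A ^ 5 :=
    (Nat.le_self_pow (by norm_num) A).trans (Nat.le_mul_of_pos_left _ (pow_pos hW 2))
  have h9 : W ≤ W ^ 2 * A ^ 5 :=
    (Nat.le_self_pow (by norm_num) W).trans (Nat.le_mul_of_pos_right _ (pow_pos hA1 5))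
  have h10 : A * (95 * (W ^ 2 * A ^ 4)) = 95 * (W ^ 2 * A ^ 5) := by ring
  have h11 : W ^ 2 * (120 * A ^ 5) = 120 * (W ^ 2 * A ^ 5) := by ring
  omega

end

/-! ### Nest-sets and index sets -/

section
variable {α : Type*} {H : Hypergraph α} {n m : ℕ} (vs : Fin n ≃ H.vertexSet)
  (es : Fin m ≃ H.edgeSet)

open Classical in
/-- The indices of the elements of the set `T`. -/
noncomputable def indices (T : Set α) : Finset ℕ :=
  (Finset.univ.filter fun j : Fin n => (vs j : α) ∈ T).map Fin.valEmbedding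

/-- The indices of the elements of the `i`-th edge. -/
noncomputable def edgeIndices (i : ℕ) : Finset ℕ :=
  if h : i < m then indices vs (es ⟨i, h⟩ : Set α) else ∅

theorem mem_indices {T : Set α} {j : ℕ} :
    j ∈ indices vs T ↔ ∃ h : j < n, (vs ⟨j, h⟩ : α) ∈ T := by
  simp only [indices, Finset.mem_map, Finset.mem_filter, Finset.mem_univ, true_and,
    Fin.valEmbedding_apply]
  constructor
  · rintro ⟨j, h, rfl⟩
    exact ⟨j.2, h⟩
  · rintro ⟨h, h'⟩
    exact ⟨⟨j, h⟩, h', rfl⟩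

theorem val_mem_indices {T : Set α} (j : Fin n) : (j : ℕ) ∈ indices vs T ↔ (vs j : α) ∈ T := by
  simp [mem_indices]

theorem indices_subset (T : Set α) : indices vs T ⊆ Finset.range n := fun _ hj =>
  Finset.mem_range.2 ((mem_indices vs).1 hj).1

theorem edgeIndices_subset (i : ℕ) : edgeIndices vs es i ⊆ Finset.range n := by
  unfold edgeIndices
  split_ifs
  · exact indices_subset _ _
  · simp

theorem edgeIndices_val (i : Fin m) : edgeIndices vs es i = indices vs (es i : Set α) := by
  simp [edgeIndices]

/-- Only vertices have indices, hence `hT`. This transfers all four clauses of `Violates`, and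
non-emptiness. -/
theorem exists_mem_indices {T : Set α} (hT : T ⊆ H.vertexSet) {p : ℕ → Prop} {q : α → Prop}
    (h : ∀ j : Fin n, p j ↔ q (vs j)) : (∃ j ∈ indices vs T, p j) ↔ ∃ x ∈ T, q x := by
  constructor
  · rintro ⟨j, hj, hp⟩
    obtain ⟨hj, hT⟩ := (mem_indices vs).1 hj
    exact ⟨_, hT, (h ⟨j, hj⟩).1 hp⟩
  · rintro ⟨x, hx, hq⟩
    obtain ⟨j, hj⟩ := vs.surjective ⟨x, hT hx⟩
    have hj' : (vs j : α) = x := by rw [hj]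
    exact ⟨j, (val_mem_indices vs j).2 (hj' ▸ hx), (h j).2 (hj' ▸ hq)⟩

theorem violates_indices {A B T : Set α} (hA : A ⊆ H.vertexSet) (hB : B ⊆ H.vertexSet) :
    Violates (indices vs A) (indices vs B) (indices vs T) ↔
      (∃ x ∈ A, x ∈ T) ∧ (∃ x ∈ B, x ∈ T) ∧ (∃ x ∈ A, x ∉ B ∧ x ∉ T) ∧
        ∃ x ∈ B, x ∉ A ∧ x ∉ T := by
  unfold Violates
  rw [exists_mem_indices vs hA fun j => val_mem_indices vs j,
    exists_mem_indices vs hB fun j => val_mem_indices vs j,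
    exists_mem_indices vs hA (q := fun x => x ∉ B ∧ x ∉ T) fun j => and_congr (val_mem_indices vs j).not
      (val_mem_indices vs j).not,
    exists_mem_indices vs hB (q := fun x => x ∉ A ∧ x ∉ T) fun j => and_congr (val_mem_indices vs j).not
      (val_mem_indices vs j).not]

/-- Two remainders are incomparable iff each edge has an element outside the other edge and outside
`T`, which is what the last two clauses of `Violates` say; the first two express incidence with `T`.
-/
theorem nest_indices (T : Set α) : Nest (edgeIndices vs es) m (indices vs T) ↔
    IsChain (fun a b : Set α => a ⊆ b) (H.incidentRemainders T) := by
  have hV (i : Fin m) : (es i : Set α) ⊆ H.vertexSet :=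
    H.subset_vertexSet_of_mem_edgeSet' (es i).2
  constructor
  · rintro h _ ⟨e, ⟨he, x, hxT, hx⟩, rfl⟩ _ ⟨f, ⟨hf, y, hyT, hy⟩, rfl⟩ -
    obtain ⟨i, hi⟩ := es.surjective ⟨e, he⟩
    obtain ⟨i', hi'⟩ := es.surjective ⟨f, hf⟩
    have := h i i.2 i' i'.2
    rw [edgeIndices_val, edgeIndices_val, violates_indices vs (hV i) (hV i'), hi, hi'] at this
    by_contra! hc
    obtain ⟨p, hp, hp'⟩ := Set.not_subset.1 hc.1
    obtain ⟨q, hq, hq'⟩ := Set.not_subset.1 hc.2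
    exact this ⟨⟨x, hx, hxT⟩, ⟨y, hy, hyT⟩, ⟨p, hp.1, fun h => hp' ⟨h, hp.2⟩, hp.2⟩,
      ⟨q, hq.1, fun h => hq' ⟨h, hq.2⟩, hq.2⟩⟩
  · intro h i hi i' hi' hv
    have e := edgeIndices_val vs es ⟨i, hi⟩
    have e' := edgeIndices_val vs es ⟨i', hi'⟩
    simp only at e e'
    rw [e, e', violates_indices vs (hV _) (hV _)] at hv
    obtain ⟨⟨x, hx, hxT⟩, ⟨y, hy, hyT⟩, ⟨p, hp, hp', hpT⟩, ⟨q, hq, hq', hqT⟩⟩ := hv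
    -- `total` also covers different edges with equal remainders, about which a chain says nothing
    -- by definition.
    rcases h.total ⟨_, ⟨(es ⟨i, hi⟩).2, x, hxT, hx⟩, rfl⟩
      ⟨_, ⟨(es ⟨i', hi'⟩).2, y, hyT, hy⟩, rfl⟩ with h | h
    · exact hp' (h ⟨hp, hpT⟩).1
    · exact hq' (h ⟨hq, hqT⟩).1

theorem encard_eq_card_indices {T : Set α} (hT : T ⊆ H.vertexSet) :
    T.encard = (indices vs T).card := by
  classical
  have hinj : Function.Injective fun j : Fin n => (vs j : α) :=
    Subtype.val_injective.comp vs.injective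
  have : T = (fun j : Fin n => (vs j : α)) ''
      (Finset.univ.filter fun j : Fin n => (vs j : α) ∈ T : Finset (Fin n)) := by
    ext x
    simp only [Set.mem_image, Finset.coe_filter, Finset.mem_univ, true_and, Set.mem_ofPred_eq]
    constructor
    · intro hx
      obtain ⟨j, hj⟩ := vs.surjective ⟨x, hT hx⟩
      have hj' : (vs j : α) = x := by rw [hj]
      exact ⟨j, hj' ▸ hx, hj'⟩
    · rintro ⟨j, hj, rfl⟩
      exact hj
  conv_lhs => rw [this]
  rw [hinj.encard_image, Set.encard_coe_eq_coe_finsetCard, indices, Finset.card_map]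

theorem isKNestSet_iff {k : ℕ} {T : Set α} (hT : T ⊆ H.vertexSet) :
    H.IsKNestSet k T ↔ Solution (edgeIndices vs es) n m k (indices vs T) := by
  have hne : (indices vs T).Nonempty ↔ T.Nonempty := by
    have := exists_mem_indices vs hT (p := fun _ => True) (q := fun _ => True) (by simp)
    simpa [Finset.Nonempty, Set.Nonempty] using this
  constructor
  · rintro ⟨h, hk⟩
    refine ⟨hne.2 h.nonempty, indices_subset _ _, (nest_indices vs es T).2 h.chain, ?_⟩
    rw [encard_eq_card_indices vs hT] at hk
    exact_mod_cast hk
  · intro h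
    refine ⟨⟨hne.1 h.nonempty, hT, (nest_indices vs es T).1 h.nest⟩, ?_⟩
    rw [encard_eq_card_indices vs hT]
    exact_mod_cast h.card_le

theorem exists_indices_eq {S : Finset ℕ} (hS : S ⊆ Finset.range n) :
    ∃ T ⊆ H.vertexSet, indices vs T = S := by
  refine ⟨{x | ∃ j : Fin n, (j : ℕ) ∈ S ∧ (vs j : α) = x}, ?_, ?_⟩
  · rintro _ ⟨j, -, rfl⟩
    exact (vs j).2
  · ext j
    rw [mem_indices]
    constructor
    · rintro ⟨hj, l, hl, hlj⟩
      have := vs.injective (Subtype.ext hlj)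
      rw [this] at hl
      exact hl
    · intro hj
      exact ⟨Finset.mem_range.1 (hS hj), _, hj, rfl⟩

theorem mem_inputState (k : ℕ) :
    Mem (edgeIndices vs es) n m ∅ (H.inputState vs es k).mem := by
  constructor
  · intro i hi j hj
    have e := edgeIndices_val vs es ⟨i, hi⟩
    simp only at e
    rw [e]
    have hiff : (∃ (i' : Fin m) (j' : Fin n), i * n + j = i' * n + j' ∧
        (vs j' : α) ∈ (es i' : Set α)) ↔ j ∈ indices vs (es ⟨i, hi⟩ : Set α) := by
      rw [mem_indices]
      constructor
      · rintro ⟨i', j', h, h'⟩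
        -- Division by `n` recovers the row from the address, so no other incidence can set this
        -- cell.
        have hd (a b : ℕ) (hb : b < n) : (a * n + b) / n = a := by
          rw [mul_comm, Nat.mul_add_div (by omega), Nat.div_eq_of_lt hb, add_zero]
        have hii : i = i' := by rw [← hd i j hj, h, hd _ _ j'.2]
        subst hii
        have hjj : j = j' := by omega
        subst hjj
        exact ⟨j'.2, h'⟩
      · rintro ⟨hj, h⟩
        exact ⟨⟨i, hi⟩, ⟨j, hj⟩, rfl, h⟩
    simp only [Hypergraph.inputState, hiff]
  -- The matrix ends before address `m * n`, so the block for the current set is initially zero.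
  · intro j _
    simp only [Finset.notMem_empty, if_false]
    refine if_neg ?_
    rintro ⟨i, l, h, -⟩
    have := Nat.mul_le_mul_right n i.2
    rw [Nat.succ_mul] at this
    have := l.2
    omega

theorem size_eq (vs : Fin n ≃ H.vertexSet) (es : Fin m ≃ H.edgeSet) : H.size = n + m := by
  have h1 := Nat.card_congr vs
  have h2 := Nat.card_congr es
  rw [Nat.card_fin, Nat.card_coe_set_eq] at h1 h2
  rw [Hypergraph.size, h1, h2]

end
end NestSearch

/-! ### The theorem for hypergraphs. -/

theorem theorem5p6 :
    ∃ (P : RAM.Prog) (c : ℕ) (p : Polynomial ℕ),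
      ∀ (α : Type*) (H : Hypergraph α) (n m : ℕ)
        (vs : Fin n ≃ H.vertexSet) (es : Fin m ≃ H.edgeSet) (k : ℕ), 1 ≤ k →
        ∃ (t : ℕ) (σ : RAM.State),
          RAM.Exec P (H.inputState vs es k) t σ ∧
          t ≤ 2 ^ (c * k ^ 2) * p.eval H.size ∧
          ((∃ s : Set α, H.IsKNestSet k s) →
            ∃ s : Set α, H.IsKNestSet k s ∧ H.Returns vs σ s) ∧
          ((¬ ∃ s : Set α, H.IsKNestSet k s) → Hypergraph.Rejects σ) := by
  -- The constants are those of `time_le`, whose exponent `2 * k` is at most `2 * k ^ 2`.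
  refine ⟨NestSearch.prog, 2, 120 * (Polynomial.X + 1) ^ 5, fun α H n m vs es k hk => ?_⟩
  obtain ⟨t, σ, he, ht, h⟩ := NestSearch.wp_prog (k := k) (σ := H.inputState vs es k)
    (fun i _ => NestSearch.edgeIndices_subset vs es i) (by simp [Hypergraph.inputState])
    (by simp [Hypergraph.inputState]) (by simp [Hypergraph.inputState])
    (by simp [Hypergraph.inputState]) (by simp [Hypergraph.inputState])
    (NestSearch.mem_inputState vs es k)
  have hex : (∃ s : Set α, H.IsKNestSet k s) ↔
      ∃ S, NestSearch.Solution (NestSearch.edgeIndices vs es) n m k S := by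
    constructor
    · rintro ⟨T, hT⟩
      exact ⟨_, (NestSearch.isKNestSet_iff vs es hT.1.subset).1 hT⟩
    · rintro ⟨S, hS⟩
      obtain ⟨T, hT, rfl⟩ := NestSearch.exists_indices_eq vs hS.subset
      exact ⟨T, (NestSearch.isKNestSet_iff vs es hT).2 hS⟩
  refine ⟨t, σ, he, ?_, ?_, ?_⟩
  · refine (ht.trans (NestSearch.time_le n m k)).trans ?_
    simp only [NestSearch.size_eq vs es, Polynomial.eval_mul, Polynomial.eval_pow,
      Polynomial.eval_add, Polynomial.eval_X, Polynomial.eval_one, Polynomial.eval_ofNat]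
    refine Nat.mul_le_mul_right _ (Nat.pow_le_pow_right (by norm_num) ?_)
    exact Nat.mul_le_mul_left 2 (Nat.le_self_pow (by norm_num) k)
  · intro hs
    rcases h with ⟨S, hS, h0, hm, h1⟩ | ⟨-, h⟩
    · obtain ⟨T, hT, rfl⟩ := NestSearch.exists_indices_eq vs hS.subset
      refine ⟨T, (NestSearch.isKNestSet_iff vs es hT).2 hS, h0, fun j => ?_⟩
      rw [h1, hm.cur j j.2]
      have hj := NestSearch.val_mem_indices vs (T := T) j
      exact ⟨fun h => if_pos (hj.2 h), fun h => if_neg (mt hj.1 h)⟩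
    · exact absurd (hex.1 hs) h
  · intro hs
    rcases h with ⟨S, hS, -⟩ | ⟨h, -⟩
    · exact absurd (hex.2 ⟨S, hS⟩) hs
    · exact h
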